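/- **Setting.** Fix $n$ agents with weights $w_1,\dots,w_n>0$ and opinions in $\mathbb{R}^d$ with Euclidean norm $|\cdot|$. With the indicator interaction $\xi=1_{[0,1)}$, the opinion dynamics is $$\dot x_i=f_i(x)=\sum_{j}\xi(|x_j-x_i|)\,w_j\,(x_j-x_i).$$ A *solution* starting at $a$ is a Filippov solution on $[0,\infty)$: a locally absolutely continuous $x(t)$ with $x(0)=a$ and $\dot x(t)\in\mathcal F(x(t))$ for almost every $t\ge 0$, where $$\mathcal F(x)=\bigcap_{r>0}\ \bigcap_{\mathrm{meas}(N)=0}\overline{\mathrm{co}}\,f(B(x,r)\setminus N).$$ A point $x^*$ is an *equilibrium* if the constant function $x^*$ is the unique solution starting at $x^*$. Let $x^*=(x^*_1,\dots,x^*_n)$ be an equilibrium. Its *clusters* are its distinct values $c_1,\dots,c_k$. The weight $W_a>0$ of $c_a$ is the total weight of the agents with opinion $c_a$. (If all agents have distinct opinions, clusters are just agents.) Let $B_a$ be the open unit ball and $\Sigma_a$ the unit sphere centered at $c_a$. For nonempty $S\subset\{1,\dots,k\}$ let $$m^*_S=\frac{\sum_{a\in S}W_a c_a}{\sum_{a\in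 S}W_a},\qquad m^*_{ab}=m^*_{\{a,b\}}.$$ The equilibrium is *generic* if no two of the spheres $\Sigma_a$ are tangential, no three of them have a common point, and no $m^*_S$ with $S\neq\emptyset$ lies on any of them. It satisfies the *shared center of mass condition* if there is $S$ with at least two elements such that $m^*_S\in\bigcap_{a\in S}B_a$. For $x_0^*\in\mathbb{R}^d$ and $\delta>0$ introduce a zero agent with weight $\delta$ and initial opinion $x^*_0$, which interacts with all agents through the same $\xi$. Let $$\Delta(x_0^*,\delta;x^*)=\sup|\tilde x_i(t)-x^*_i|\in[0,\infty],$$ where the supremum is over $i=1,\dots,n$, all $t\ge0$, and all solutions $\tilde x$ of the $(n+1)$-agent system starting at $(x^*_0,x^*_1,\dots,x^*_n)$. **Theorem.** Let $x^*$ be a generic equilibrium that does not satisfy the shared center of mass condition. Suppose that $B_a\cap B_b\cap B_c=\emptyset$ for any three distinct $a,b,c$, and that for all $a\neq b$ either $|m^*_{ab}-c_a|>\sqrt2$ or $|m^*_{ab}-c_b|>\sqrt2$. Then $x^*$ is robust almost surely and uniformly: there is a set $Z\subset\mathbb{R}^d$ of Lebesgue measure zero such that $$\lim_{\delta\to0+}\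 \sup_{x_0^*\in\mathbb{R}^d\setminus Z}\Delta(x_0^*,\delta;x^*)=0.$$ -/

import Mathlib

open MeasureTheory Filter Topology

namespace OpinionDynamics

/-- The space of opinions, `ℝ^d` with its Euclidean norm. -/
abbrev Opinion (d : ℕ) : Type := EuclideanSpace ℝ (Fin d)

/-- The interaction function: the indicator function of `[0, 1)`. -/
noncomputable def interaction : ℝ → ℝ := Set.indicator (Set.Ico (0 : ℝ) 1) (fun _ => (1 : ℝ))

/-- The (discontinuous) vector field of the opinion dynamics of finitely many agents, indexed
by `ι`, with weights `w`:
`f_i(x) = ∑_j ξ(|x_j - x_i|) w_j (x_j - x_i)`. -/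
noncomputable def field {ι : Type*} [Fintype ι] {d : ℕ} (w : ι → ℝ) (x : ι → Opinion d) :
    ι → Opinion d :=
  fun i => ∑ j, (interaction ‖x j - x i‖ * w j) • (x j - x i)

/-- The Filippov set-valued map of a vector field `f` on the state space: the intersection, over
all radii `r > 0` and all Lebesgue null sets `N`, of the closed convex hull of
`f (B(x, r) \ N)`.  (Balls are taken in the norm `max_i |x_i|`; since all radii occur, any other
norm on this finite-dimensional space gives the same set.) -/
def filippovMap {ι : Type*} [Fintype ι] {d : ℕ}
    (f : (ι → Opinion d) → (ι → Opinion d)) (x : ι → Opinion d) : Set (ι → Opinion d) :=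
  ⋂ (r : ℝ) (_ : 0 < r) (N : Set (ι → Opinion d)) (_ : volume N = 0),
    closure (convexHull ℝ (f '' (Metric.ball x r \ N)))

/-- `X` (restricted to times `t ≥ 0`) is a Filippov solution of the opinion dynamics with
weights `w` and initial condition `x₀`: it is absolutely continuous on bounded time intervals,
it starts at `x₀`, and its derivative lies in the Filippov map at almost every time. -/
structure IsSolution {ι : Type*} [Fintype ι] {d : ℕ} (w : ι → ℝ) (x₀ : ι → Opinion d)
    (X : ℝ → ι → Opinion d) : Prop where
  initial : X 0 = x₀
  absolutelyContinuous : ∀ T : ℝ, 0 < T → AbsolutelyContinuousOnInterval X 0 T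
  inclusion : ∀ᵐ t : ℝ, 0 < t → ∃ v ∈ filippovMap (field w) (X t), HasDerivAt X v t

/-- `x` is an equilibrium: the constant function `x` is the unique solution starting at `x`. -/
def IsEquilibrium {ι : Type*} [Fintype ι] {d : ℕ} (w : ι → ℝ) (x : ι → Opinion d) : Prop :=
  IsSolution w x (fun _ => x) ∧
    ∀ X : ℝ → ι → Opinion d, IsSolution w x X → ∀ t : ℝ, 0 ≤ t → X t = x

/-- The clusters of a configuration are its distinct opinion values. -/
def clusters {n d : ℕ} (x : Fin n → Opinion d) : Set (Opinion d) := Set.range x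

open Classical in
/-- The weight of the cluster at `y`: the total weight of all agents with opinion `y`. -/
noncomputable def clusterWeight {n d : ℕ} (w : Fin n → ℝ) (x : Fin n → Opinion d)
    (y : Opinion d) : ℝ :=
  ∑ i with x i = y, w i

/-- The center of mass `m_S` of a finite set `S` of clusters. -/
noncomputable def centerOfMass {n d : ℕ} (w : Fin n → ℝ) (x : Fin n → Opinion d)
    (S : Finset (Opinion d)) : Opinion d :=
  (∑ y ∈ S, clusterWeight w x y)⁻¹ • ∑ y ∈ S, clusterWeight w x y • y

/-- The center of mass `m_{yz}` of the two clusters `y` and `z`. -/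
noncomputable def pairCenter {n d : ℕ} (w : Fin n → ℝ) (x : Fin n → Opinion d)
    (y z : Opinion d) : Opinion d :=
  (clusterWeight w x y + clusterWeight w x z)⁻¹ •
    (clusterWeight w x y • y + clusterWeight w x z • z)

/-- Genericity, in terms of the unit spheres around the clusters: no two of them are tangential
(distinct spheres of equal radius can only be externally tangential), no three of them have a
common point, and no center of mass of a nonempty set of clusters lies on one of them. -/
structure IsGeneric {n d : ℕ} (w : Fin n → ℝ) (x : Fin n → Opinion d) : Prop where
  not_tangential : ∀ y ∈ clusters x, ∀ z ∈ clusters x, y ≠ z →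
    ¬ (EuclideanGeometry.Sphere.mk y 1).IsExtTangent (EuclideanGeometry.Sphere.mk z 1)
  no_triple_point : ∀ y ∈ clusters x, ∀ z ∈ clusters x, ∀ u ∈ clusters x,
    y ≠ z → y ≠ u → z ≠ u →
      Metric.sphere y 1 ∩ Metric.sphere z 1 ∩ Metric.sphere u 1 = ∅
  center_not_mem : ∀ S : Finset (Opinion d), S.Nonempty → (S : Set (Opinion d)) ⊆ clusters x →
    ∀ y ∈ clusters x, centerOfMass w x S ∉ Metric.sphere y 1

/-- The shared center of mass condition: some set `S` of at least two clusters has its center of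
mass in the intersection of the confidence balls of the clusters in `S`. -/
def SharedCenterOfMass {n d : ℕ} (w : Fin n → ℝ) (x : Fin n → Opinion d) : Prop :=
  ∃ S : Finset (Opinion d), (S : Set (Opinion d)) ⊆ clusters x ∧ 2 ≤ S.card ∧
    ∀ y ∈ S, centerOfMass w x S ∈ Metric.ball y 1

/-- The disruption `Δ(x₀, δ; x)` caused by a zero agent (the agent with index `0` in the extended
system) of weight `δ` and initial opinion `x₀`: the supremum, over all solutions of the extended
system starting at `(x₀, x_1, …, x_n)`, all times `t ≥ 0` and all original agents `i`, of the
displacement of agent `i`. -/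
noncomputable def disruption {n d : ℕ} (w : Fin n → ℝ) (x : Fin n → Opinion d)
    (x₀ : Opinion d) (δ : ℝ) : ENNReal :=
  ⨆ (X : ℝ → Fin (n + 1) → Opinion d)
    (_ : IsSolution (Fin.cons δ w : Fin (n + 1) → ℝ) (Fin.cons x₀ x : Fin (n + 1) → Opinion d) X)
    (t : ℝ) (_ : 0 ≤ t) (i : Fin n), ENNReal.ofReal ‖X t i.succ - x i‖

/-- Almost sure and uniform robustness: outside a fixed Lebesgue null set of initial zero
opinions, the disruption tends to `0` uniformly as `δ → 0+`. -/
def IsRobustAlmostSurelyUniformly {n d : ℕ} (w : Fin n → ℝ) (x : Fin n → Opinion d) : Prop :=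
  ∃ Z : Set (Opinion d), volume Z = 0 ∧
    Tendsto (fun δ : ℝ => ⨆ x₀ ∈ Zᶜ, disruption w x x₀ δ) (𝓝[>] 0) (𝓝 0)

end OpinionDynamics

/-! By the pair condition, distinct clusters are more than `√2` apart: `m_ab` lies on the segment
between them. The triple-ball condition lets a zero agent starting at `p` off all the spheres (a
null set) see at most two clusters. If it sees two, call the one with `|m_ab - c_a| > √2` the loser
`L` and the other the captor `B`; if it sees fewer, `L` or both are empty. The claim is that the
zero agent is kept by `B`, expelled for good by `L` in bounded time, and never reaches another
cluster.

The identity `2⟪z - a, b - z⟫ = |b - a|² - |z - a|² - |z - b|²` drives this. If `z` is near the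
sphere around `a`, within distance one of `b`, and `|b - a| > √2`, the pull of `b` increases `|z -
a|`. This protects the clusters outside `B ∪ L` (`inner_nonneg_of_outside`). At the loser, the pull
of `B` must also beat that of `L`, which the bound on `m_ab` ensures (`isSplit_of_pair`,
`le_inner_of_mem_loser`). The captor is at least twice as heavy as the loser, so near its sphere the
net pull is inward (`inner_nonpos_of_mem_captor`).

The displacement is bounded by momentum. Agents of one cluster stay within `O(δ)` of each other. The
loser gains momentum only up to time `1/η`, hence `O(δ/η)`; afterwards it is free. Total momentum,
with the zero agent weighted by `δ`, is conserved, which bounds the captor's displacement for all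
time.

These estimates presuppose that the configuration stays in the open region where they hold
(`InRegion`) and reproduce it strictly, so continuous induction closes the argument. Only symmetric
Filippov coefficients in `[0, 1]` are used, so all solutions are covered. The bound on `δ` depends
on `η` and on the finitely many pairs `(B, L)`, but not on the distance of `p` to the spheres; hence
the uniformity. -/

namespace OpinionDynamics

/-! ### Differential inequalities for absolutely continuous curves -/

section AbsolutelyContinuous

variable {E F : Type*} [NormedAddCommGroup E] [NormedAddCommGroup F]

theorem absolutelyContinuousOnInterval_comp {f : ℝ → E} {φ : E → F} {a b C : ℝ}
    (hf : AbsolutelyContinuousOnInterval f a b)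
    (hφ : ∀ s ∈ Set.uIcc a b, ∀ t ∈ Set.uIcc a b, dist (φ (f s)) (φ (f t)) ≤ C * dist (f s) (f t)) :
    AbsolutelyContinuousOnInterval (fun t => φ (f t)) a b := by
  rw [absolutelyContinuousOnInterval_iff] at hf ⊢
  intro ε hε
  -- `|C| + 1` avoids any sign condition on the Lipschitz constant and is never zero.
  obtain ⟨δ, hδ, H⟩ := hf (ε / (|C| + 1)) (by positivity)
  refine ⟨δ, hδ, fun E hE hlt => ?_⟩
  have h1 := H E hE hlt
  have h2 : ∑ i ∈ Finset.range E.1, dist (φ (f (E.2 i).1)) (φ (f (E.2 i).2)) ≤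
      (|C| + 1) * ∑ i ∈ Finset.range E.1, dist (f (E.2 i).1) (f (E.2 i).2) := by
    rw [Finset.mul_sum]
    refine Finset.sum_le_sum fun i hi => ?_
    obtain ⟨ha, hb⟩ := hE.1 i hi
    refine (hφ _ ha _ hb).trans ?_
    exact mul_le_mul_of_nonneg_right ((le_abs_self C).trans (by linarith)) dist_nonneg
  refine h2.trans_lt ?_
  rw [lt_div_iff₀ (by positivity)] at h1
  linarith

theorem absolutelyContinuousOnInterval_clm [NormedSpace ℝ E] [NormedSpace ℝ F] {f : ℝ → E}
    {a b : ℝ} (hf : AbsolutelyContinuousOnInterval f a b) (φ : E →L[ℝ] F) :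
    AbsolutelyContinuousOnInterval (fun t => φ (f t)) a b :=
  absolutelyContinuousOnInterval_comp (C := ‖φ‖) hf fun s _ t _ => by
    rw [dist_eq_norm, dist_eq_norm, ← map_sub]
    exact φ.le_opNorm _

theorem absolutelyContinuousOnInterval_norm_sq {f : ℝ → E} {a b : ℝ}
    (hf : AbsolutelyContinuousOnInterval f a b) :
    AbsolutelyContinuousOnInterval (fun t => ‖f t‖ ^ 2) a b := by
  obtain ⟨C, hC⟩ := hf.exists_bound
  refine absolutelyContinuousOnInterval_comp (φ := fun v => ‖v‖ ^ 2) (C := 2 * C) hf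
    fun s hs t ht => ?_
  have h1 := hC s hs
  have h2 := hC t ht
  have h3 : |‖f s‖ - ‖f t‖| ≤ dist (f s) (f t) := by
    rw [dist_eq_norm]; exact abs_norm_sub_norm_le _ _
  rw [Real.dist_eq, show ‖f s‖ ^ 2 - ‖f t‖ ^ 2 = (‖f s‖ + ‖f t‖) * (‖f s‖ - ‖f t‖) by ring,
    abs_mul, abs_of_nonneg (by positivity)]
  exact mul_le_mul (by linarith) h3 (abs_nonneg _) (by linarith [norm_nonneg (f s)])

theorem sub_le_of_ae_deriv_le {g : ℝ → ℝ} {s t c : ℝ} (hst : s ≤ t)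
    (hg : AbsolutelyContinuousOnInterval g s t)
    (h : ∀ᵐ r : ℝ, r ∈ Set.Ioo s t → ∃ g' ≤ c, HasDerivAt g g' r) :
    g t - g s ≤ c * (t - s) := by
  rw [← hg.integral_deriv_eq_sub]
  have h1 : ∫ r in s..t, deriv g r ≤ ∫ _ in s..t, c := by
    rw [intervalIntegral.integral_of_le hst, intervalIntegral.integral_of_le hst,
      integral_Ioc_eq_integral_Ioo, integral_Ioc_eq_integral_Ioo]
    refine setIntegral_mono_ae_restrict ?_ (by simp) ?_
    · exact ((intervalIntegrable_iff_integrableOn_Ioc_of_le hst).1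
        hg.intervalIntegrable_deriv).mono_set Set.Ioo_subset_Ioc_self
    · rw [EventuallyLE, ae_restrict_iff' measurableSet_Ioo]
      filter_upwards [h] with r hr hmem
      obtain ⟨g', hg', hd⟩ := hr hmem
      rw [hd.deriv]; exact hg'
  simpa [mul_comm] using h1

/-- Barrier principle: after the last time at which `g ≤ K`, the derivative is nonpositive, so `g`
cannot end above `K`. The derivative is controlled only above the barrier. -/
theorem le_of_ae_deriv_nonpos_above {g : ℝ → ℝ} {s t K : ℝ} (hst : s ≤ t)
    (hg : AbsolutelyContinuousOnInterval g s t) (h0 : g s ≤ K)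
    (h : ∀ᵐ r : ℝ, r ∈ Set.Ioo s t → K < g r → ∃ g' ≤ 0, HasDerivAt g g' r) :
    g t ≤ K := by
  by_contra hlt
  push Not at hlt
  have hcont : ContinuousOn g (Set.Icc s t) := by
    simpa [Set.uIcc_of_le hst] using hg.continuousOn
  set A : Set ℝ := Set.Icc s t ∩ g ⁻¹' Set.Iic K with hA
  have hAc : IsClosed A := hcont.preimage_isClosed_of_isClosed isClosed_Icc isClosed_Iic
  have hAne : A.Nonempty := ⟨s, ⟨le_rfl, hst⟩, h0⟩
  have hAb : BddAbove A := ⟨t, fun r hr => hr.1.2⟩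
  have hmem := hAc.csSup_mem hAne hAb
  set q := sSup A
  have hqt : q ≤ t := hmem.1.2
  have hq : g q ≤ K := hmem.2
  have hsub : AbsolutelyContinuousOnInterval g q t := hg.mono (by
    rw [Set.uIcc_of_le hqt, Set.uIcc_of_le hst]; exact Set.Icc_subset_Icc_left hmem.1.1)
  have := sub_le_of_ae_deriv_le (c := 0) hqt hsub (by
    filter_upwards [h] with r hr hr2
    refine hr ⟨hmem.1.1.trans_lt hr2.1, hr2.2⟩ ?_
    by_contra hle
    push Not at hle
    exact absurd (le_csSup hAb (show r ∈ A from ⟨⟨(hmem.1.1.trans_lt hr2.1).le, hr2.2.le⟩, hle⟩))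
      (not_le.2 hr2.1))
  linarith

/-- Projection onto the total displacement `u` reduces this to the scalar case. -/
theorem norm_sub_le_of_ae_deriv_norm_le {E : Type*} [NormedAddCommGroup E] [InnerProductSpace ℝ E]
    {F : ℝ → E} {s t c : ℝ} (hc : 0 ≤ c) (hst : s ≤ t)
    (hF : AbsolutelyContinuousOnInterval F s t)
    (h : ∀ᵐ r : ℝ, r ∈ Set.Ioo s t → ∃ v, ‖v‖ ≤ c ∧ HasDerivAt F v r) :
    ‖F t - F s‖ ≤ c * (t - s) := by
  set u := F t - F s with hu
  have h1 := sub_le_of_ae_deriv_le (g := fun r => innerSL ℝ u (F r)) (c := ‖u‖ * c) hst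
    (absolutelyContinuousOnInterval_clm hF _) (by
      filter_upwards [h] with r hr hmem
      obtain ⟨v, hv, hd⟩ := hr hmem
      refine ⟨innerSL ℝ u v, ?_, (innerSL ℝ u).hasFDerivAt.comp_hasDerivAt r hd⟩
      exact (real_inner_le_norm u v).trans (mul_le_mul_of_nonneg_left hv (norm_nonneg _)))
  rw [← map_sub, ← hu, innerSL_apply_apply, real_inner_self_eq_norm_sq] at h1
  rcases eq_or_lt_of_le (norm_nonneg u) with h0 | h0
  · rw [← h0]
    exact mul_nonneg hc (sub_nonneg.2 hst)
  · nlinarith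

end AbsolutelyContinuous

/-- A form of continuous induction along a curve: an open condition that holds initially and never
breaks for the first time holds forever. -/
theorem forall_mem_of_continuousOn {E : Type*} [TopologicalSpace E] {X : ℝ → E} {U : Set E}
    (hX : ContinuousOn X (Set.Ici 0)) (hU : IsOpen U)
    (h : ∀ τ, 0 ≤ τ → (∀ t, 0 ≤ t → t < τ → X t ∈ U) → X τ ∈ U) (t : ℝ) (ht : 0 ≤ t) :
    X t ∈ U := by
  by_contra hmem
  set A : Set ℝ := Set.Ici 0 ∩ X ⁻¹' Uᶜ with hA
  have hAc : IsClosed A := hX.preimage_isClosed_of_isClosed isClosed_Ici hU.isClosed_compl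
  have hAb : BddBelow A := ⟨0, fun r hr => hr.1⟩
  have hq := hAc.csInf_mem ⟨t, ht, hmem⟩ hAb
  refine hq.2 (h _ hq.1 fun r hr hlt => ?_)
  by_contra hr2
  exact absurd (csInf_le hAb (show r ∈ A from ⟨hr, hr2⟩)) (not_le.2 hlt)

end OpinionDynamics

/-! ### Filippov velocities as symmetric interaction coefficients -/

namespace OpinionDynamics

/-- Symmetric interaction coefficients that are compatible with a configuration: they are
determined by the interaction function except for agents at distance exactly one. -/
structure IsCompatible {ι : Type*} {d : ℕ} (x : ι → Opinion d) (θ : ι → ι → ℝ) : Prop where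
  symm : ∀ i j, θ i j = θ j i
  nonneg : ∀ i j, 0 ≤ θ i j
  le_one : ∀ i j, θ i j ≤ 1
  eq_one : ∀ i j, ‖x j - x i‖ < 1 → θ i j = 1
  eq_zero : ∀ i j, 1 < ‖x j - x i‖ → θ i j = 0

theorem interaction_of_lt {s : ℝ} (h0 : 0 ≤ s) (h1 : s < 1) : interaction s = 1 :=
  Set.indicator_of_mem (show s ∈ Set.Ico (0 : ℝ) 1 from ⟨h0, h1⟩) _

theorem interaction_of_one_le {s : ℝ} (h1 : 1 ≤ s) : interaction s = 0 :=
  Set.indicator_of_notMem (fun h : s ∈ Set.Ico (0 : ℝ) 1 => absurd h.2 (not_lt.2 h1)) _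

theorem interaction_nonneg (s : ℝ) : 0 ≤ interaction s :=
  Set.indicator_nonneg (fun _ _ => zero_le_one) s

theorem interaction_le_one (s : ℝ) : interaction s ≤ 1 :=
  Set.indicator_le_self' (fun _ _ => zero_le_one) s |>.trans le_rfl

variable {ι : Type*} {d : ℕ}

theorem isCompact_compatible (x : ι → Opinion d) : IsCompact {θ | IsCompatible x θ} := by
  refine (isCompact_Icc (a := (0 : ι → ι → ℝ)) (b := 1)).of_isClosed_subset ?_
    fun θ hθ => ⟨fun i j => hθ.nonneg i j, fun i j => hθ.le_one i j⟩
  have : {θ | IsCompatible x θ} = ⋂ i, ⋂ j, ({θ : ι → ι → ℝ | θ i j = θ j i} ∩ {θ | 0 ≤ θ i j} ∩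
      {θ | θ i j ≤ 1} ∩ {θ | ‖x j - x i‖ < 1 → θ i j = 1} ∩ {θ | 1 < ‖x j - x i‖ → θ i j = 0}) := by
    ext θ
    simp only [Set.mem_iInter, Set.mem_inter_iff, Set.mem_ofPred_eq]
    exact ⟨fun h i j => ⟨⟨⟨⟨h.1 i j, h.2 i j⟩, h.3 i j⟩, h.4 i j⟩, h.5 i j⟩,
      fun h => ⟨fun i j => (h i j).1.1.1.1, fun i j => (h i j).1.1.1.2, fun i j => (h i j).1.1.2,
        fun i j => (h i j).1.2, fun i j => (h i j).2⟩⟩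
  rw [this]
  refine isClosed_iInter fun i => isClosed_iInter fun j => ?_
  have hc : ∀ i j, Continuous fun θ : ι → ι → ℝ => θ i j := fun i j => by fun_prop
  refine ((((isClosed_eq (hc i j) (hc j i)).inter (isClosed_le continuous_const (hc i j))).inter
    (isClosed_le (hc i j) continuous_const)).inter ?_).inter ?_
  · exact isClosed_imp (by by_cases h : ‖x j - x i‖ < 1 <;> simp [h])
      (isClosed_eq (hc i j) continuous_const)
  · exact isClosed_imp (by by_cases h : 1 < ‖x j - x i‖ <;> simp [h])
      (isClosed_eq (hc i j) continuous_const)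

theorem convex_compatible (x : ι → Opinion d) : Convex ℝ {θ | IsCompatible x θ} := by
  intro θ hθ φ hφ a b ha hb hab
  refine ⟨fun i j => ?_, fun i j => ?_, fun i j => ?_, fun i j h => ?_, fun i j h => ?_⟩ <;>
    simp only [Pi.add_apply, Pi.smul_apply, smul_eq_mul]
  · rw [hθ.symm, hφ.symm]
  · have := hθ.nonneg i j
    have := hφ.nonneg i j
    positivity
  · nlinarith [hθ.le_one i j, hφ.le_one i j]
  · rw [hθ.eq_one i j h, hφ.eq_one i j h]; linarith
  · rw [hθ.eq_zero i j h, hφ.eq_zero i j h]; simp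

variable [Fintype ι]

/-- The velocities that result from interaction coefficients. -/
noncomputable def velocity (w : ι → ℝ) (x : ι → Opinion d) :
    (ι → ι → ℝ) →ₗ[ℝ] (ι → Opinion d) where
  toFun θ i := ∑ j, (θ i j * w j) • (x j - x i)
  map_add' θ φ := by
    ext1 i
    simp only [Pi.add_apply, add_mul, add_smul, Finset.sum_add_distrib]
  map_smul' c θ := by
    ext1 i
    simp only [Pi.smul_apply, smul_eq_mul, mul_assoc, mul_smul, Finset.smul_sum, RingHom.id_apply]

/-- The Filippov map of the opinion dynamics only contains velocities that come from symmetric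
interaction coefficients compatible with the configuration. -/
theorem exists_compatible_of_mem_filippovMap {w : ι → ℝ} {x v : ι → Opinion d}
    (hv : v ∈ filippovMap (field w) x) :
    ∃ θ, IsCompatible x θ ∧ ∀ i, v i = ∑ j, (θ i j * w j) • (x j - x i) := by
  set K : Set (ι → Opinion d) := velocity w x '' {θ | IsCompatible x θ} with hK
  have hcont : Continuous (velocity w x) := LinearMap.continuous_of_finiteDimensional _
  have hKc : IsCompact K := (isCompact_compatible x).image hcont
  have hKconv : Convex ℝ K := (convex_compatible x).linear_image _
  suffices h : v ∈ K by
    obtain ⟨θ, hθ, rfl⟩ := h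
    exact ⟨θ, hθ, fun i => rfl⟩
  -- `K` is compact and convex, so it suffices that each closed `ρ`-thickening, again convex,
  -- contains the field near `x`.
  rw [← hKc.isClosed.closure_eq, Metric.closure_eq_iInter_cthickening]
  simp only [Set.mem_iInter]
  intro ρ hρ
  have hsub : ∀ᶠ y in 𝓝 x, field w y ∈ Metric.cthickening ρ K := by
    have h1 : ∀ᶠ y in 𝓝 x, ∀ i j, ‖x j - x i‖ < 1 → ‖y j - y i‖ < 1 := by
      refine eventually_all.2 fun i => eventually_all.2 fun j => ?_
      by_cases h : ‖x j - x i‖ < 1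
      · have : Continuous fun y : ι → Opinion d => ‖y j - y i‖ := by fun_prop
        filter_upwards [this.continuousAt.eventually_lt_const h] with y hy _ using hy
      · exact Eventually.of_forall fun y hy => absurd hy h
    have h2 : ∀ᶠ y in 𝓝 x, ∀ i j, 1 < ‖x j - x i‖ → 1 < ‖y j - y i‖ := by
      refine eventually_all.2 fun i => eventually_all.2 fun j => ?_
      by_cases h : 1 < ‖x j - x i‖
      · have : Continuous fun y : ι → Opinion d => ‖y j - y i‖ := by fun_prop
        filter_upwards [this.continuousAt.eventually_const_lt h] with y hy _ using hy
      · exact Eventually.of_forall fun y hy => absurd hy h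
    have h3 : ∀ᶠ y in 𝓝 x, ∀ i, ∑ j, |w j| * ‖(y j - y i) - (x j - x i)‖ < ρ := by
      refine eventually_all.2 fun i => ?_
      have : Continuous fun y : ι → Opinion d => ∑ j, |w j| * ‖(y j - y i) - (x j - x i)‖ := by
        fun_prop
      refine this.continuousAt.eventually_lt_const ?_
      simpa using hρ
    filter_upwards [h1, h2, h3] with y h1 h2 h3
    -- Near `x`, the coefficients at `y` can differ from those at `x` only for pairs at distance
    -- exactly one in `x`, where compatibility leaves them free.
    have hcomp : IsCompatible x fun i j => interaction ‖y j - y i‖ :=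
      ⟨fun i j => by rw [norm_sub_rev], fun i j => interaction_nonneg _,
        fun i j => interaction_le_one _, fun i j h => interaction_of_lt (norm_nonneg _) (h1 i j h),
        fun i j h => interaction_of_one_le (h2 i j h).le⟩
    refine Metric.mem_cthickening_of_dist_le _ _ _ _ ⟨_, hcomp, rfl⟩ ?_
    rw [dist_pi_le_iff hρ.le]
    intro i
    refine le_trans ?_ (h3 i).le
    rw [dist_eq_norm]
    change ‖∑ j, (interaction ‖y j - y i‖ * w j) • (y j - y i) -
      ∑ j, (interaction ‖y j - y i‖ * w j) • (x j - x i)‖ ≤ _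
    rw [← Finset.sum_sub_distrib]
    refine (norm_sum_le _ _).trans (Finset.sum_le_sum fun j _ => ?_)
    rw [← smul_sub, norm_smul, norm_mul, Real.norm_eq_abs, Real.norm_eq_abs,
      abs_of_nonneg (interaction_nonneg _)]
    refine mul_le_mul_of_nonneg_right ?_ (norm_nonneg _)
    exact mul_le_of_le_one_left (abs_nonneg _) (interaction_le_one _)
  obtain ⟨r, hr, hball⟩ := Metric.eventually_nhds_iff_ball.1 hsub
  simp only [filippovMap, Set.mem_iInter] at hv
  refine closure_minimal (convexHull_min ?_ (hKconv.cthickening ρ)) Metric.isClosed_cthickening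
    (hv r hr ∅ measure_empty)
  rintro _ ⟨y, hy, rfl⟩
  exact hball y hy.1

end OpinionDynamics

/-! ### Captor, loser and the region of controlled motion -/

namespace OpinionDynamics

open scoped Classical RealInnerProductSpace

variable {n d : ℕ} {w : Fin n → ℝ} {x : Fin n → Opinion d} {B L : Finset (Fin n)} {η δ : ℝ}

/-- The agents in `B` form the cluster that finally captures the zero agent, and the agents in `L`
form a cluster that the zero agent leaves. The numbers `η` and `δ` are a spatial tolerance and the
weight of the zero agent. Both clusters may be empty. -/
structure IsScenario (w : Fin n → ℝ) (x : Fin n → Opinion d) (B L : Finset (Fin n)) (η δ : ℝ) :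
    Prop where
  weight_pos : ∀ i, 0 < w i
  tol_pos : 0 < η
  tol_le : η ≤ 1 / 20
  separated : ∀ i j, x j ≠ x i → √2 + 4 * η ≤ ‖x j - x i‖
  disjoint : Disjoint B L
  mem_captor : ∀ i ∈ B, ∀ j, j ∈ B ↔ x j = x i
  mem_loser : ∀ i ∈ L, ∀ j, j ∈ L ↔ x j = x i
  loser_light : 2 * ∑ i ∈ L, w i ≤ ∑ i ∈ B, w i
  loser_push : ∀ i ∈ L, (1 + η) * ∑ j ∈ L, w j + η ≤
    ∑ j ∈ B, w j * (((‖x j - x i‖ - 2 * η) ^ 2 - (1 + η) ^ 2 - 1) / 2)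
  zero_pos : 0 < δ
  zero_le_tol : 10 * δ ≤ η
  zero_le_weight : ∀ i, 10 * δ ≤ w i
  zero_small : ∀ i, 2 * (δ * ((∑ j, w j) / η + 4)) < η * w i

/-- The configurations in which the agents are close to `x`, the zero agent interacts with the
agents in `B`, and possibly with those in `L`, but with no others. -/
structure InRegion (x : Fin n → Opinion d) (B L : Finset (Fin n)) (η : ℝ)
    (Y : Fin (n + 1) → Opinion d) : Prop where
  near : ∀ i : Fin n, ‖Y i.succ - x i‖ < η
  inside : ∀ i ∈ B, ‖Y 0 - Y i.succ‖ < 1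
  outside : ∀ i ∉ B, i ∉ L → 1 < ‖Y 0 - Y i.succ‖

/-- The velocity `v` at the configuration `Y` results from the full interaction inside the
clusters and from interaction coefficients `θ` with the zero agent. -/
structure IsDrift (w : Fin n → ℝ) (x : Fin n → Opinion d) (δ : ℝ)
    (Y v : Fin (n + 1) → Opinion d) (θ : Fin n → ℝ) : Prop where
  nonneg : ∀ i, 0 ≤ θ i
  le_one : ∀ i, θ i ≤ 1
  eq_one : ∀ i, ‖Y 0 - Y i.succ‖ < 1 → θ i = 1
  eq_zero : ∀ i, 1 < ‖Y 0 - Y i.succ‖ → θ i = 0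
  zero_eq : v 0 = ∑ j, (θ j * w j) • (Y j.succ - Y 0)
  succ_eq : ∀ i : Fin n, v i.succ = ∑ j with x j = x i, w j • (Y j.succ - Y i.succ) +
    (δ * θ i) • (Y 0 - Y i.succ)

theorem isOpen_inRegion (x : Fin n → Opinion d) (B L : Finset (Fin n)) (η : ℝ) :
    IsOpen {Y | InRegion x B L η Y} := by
  have : {Y | InRegion x B L η Y} = (⋂ i : Fin n, {Y | ‖Y i.succ - x i‖ < η}) ∩
      (⋂ i : Fin n, {Y | i ∈ B → ‖Y 0 - Y i.succ‖ < 1}) ∩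
      (⋂ i : Fin n, {Y | (i ∉ B ∧ i ∉ L) → 1 < ‖Y 0 - Y i.succ‖}) := by
    ext Y
    simp only [Set.mem_iInter, Set.mem_inter_iff, Set.mem_ofPred_eq]
    exact ⟨fun h => ⟨⟨h.1, h.2⟩, fun i hi => h.3 i hi.1 hi.2⟩,
      fun h => ⟨h.1.1, h.1.2, fun i h1 h2 => h.2 i ⟨h1, h2⟩⟩⟩
  rw [this]
  refine ((isOpen_iInter_of_finite fun i => ?_).inter (isOpen_iInter_of_finite fun i => ?_)).inter
    (isOpen_iInter_of_finite fun i => ?_)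
  · exact isOpen_lt (by fun_prop) (by fun_prop)
  · by_cases h : i ∈ B
    · simpa [h] using isOpen_lt (by fun_prop) (by fun_prop)
    · simp [h]
  · by_cases h : i ∉ B ∧ i ∉ L
    · simpa [h] using isOpen_lt (by fun_prop) (by fun_prop)
    · simp [h]

namespace InRegion

theorem norm_sub_lt_of_eq {Y : Fin (n + 1) → Opinion d} (hY : InRegion x B L η Y) {i j : Fin n}
    (h : x j = x i) : ‖Y j.succ - Y i.succ‖ < 2 * η := by
  have h1 := hY.near i
  have h2 := hY.near j
  calc ‖Y j.succ - Y i.succ‖ = ‖(Y j.succ - x j) - (Y i.succ - x i)‖ := by rw [h]; congr 1; abel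
    _ ≤ ‖Y j.succ - x j‖ + ‖Y i.succ - x i‖ := norm_sub_le _ _
    _ < 2 * η := by linarith

theorem lt_norm_sub {Y : Fin (n + 1) → Opinion d} (hY : InRegion x B L η Y) (i j : Fin n) :
    ‖x j - x i‖ - 2 * η < ‖Y j.succ - Y i.succ‖ := by
  have h1 := hY.near i
  have h2 := hY.near j
  have h3 : ‖x j - x i‖ ≤ ‖Y j.succ - Y i.succ‖ + ‖Y i.succ - x i‖ + ‖Y j.succ - x j‖ := by
    calc ‖x j - x i‖ = ‖(Y j.succ - Y i.succ) + (Y i.succ - x i) - (Y j.succ - x j)‖ := by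
          congr 1; abel
      _ ≤ _ := (norm_sub_le _ _).trans (by gcongr; exact norm_add_le _ _)
  linarith

end InRegion

namespace IsDrift

theorem norm_smul_le {Y v : Fin (n + 1) → Opinion d} {θ : Fin n → ℝ}
    (hd : IsDrift w x δ Y v θ) (i : Fin n) : ‖θ i • (Y 0 - Y i.succ)‖ ≤ 1 := by
  rw [norm_smul, Real.norm_of_nonneg (hd.nonneg i)]
  rcases le_or_gt ‖Y 0 - Y i.succ‖ 1 with h | h
  · exact mul_le_one₀ (hd.le_one i) (norm_nonneg _) h
  · rw [hd.eq_zero i h]; simp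

/-- Inside a saturated set of agents, the interaction between the agents preserves momentum. -/
theorem sum_smul_drift {Y v : Fin (n + 1) → Opinion d} {θ : Fin n → ℝ}
    (hd : IsDrift w x δ Y v θ) {S : Finset (Fin n)} (hS : ∀ i ∈ S, ∀ j, x j = x i → j ∈ S) :
    ∑ i ∈ S, w i • v i.succ = δ • ∑ i ∈ S, w i • θ i • (Y 0 - Y i.succ) := by
  have h0 : ∑ i ∈ S, ∑ j with x j = x i, w i • w j • (Y j.succ - Y i.succ) = 0 := by
    have h1 : ∑ i ∈ S, ∑ j with x j = x i, w i • w j • (Y j.succ - Y i.succ) =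
        ∑ i ∈ S, ∑ j ∈ S, if x j = x i then w i • w j • (Y j.succ - Y i.succ) else 0 := by
      refine Finset.sum_congr rfl fun i hi => ?_
      rw [← Finset.sum_filter]
      refine Finset.sum_congr ?_ fun _ _ => rfl
      ext j
      simpa using hS i hi j
    have h2 := Finset.sum_comm (s := S) (t := S)
      (f := fun i j => if x j = x i then w i • w j • (Y j.succ - Y i.succ) else 0)
    have h3 : ∑ j ∈ S, ∑ i ∈ S, (if x j = x i then w i • w j • (Y j.succ - Y i.succ) else 0) =
        -∑ i ∈ S, ∑ j ∈ S, if x j = x i then w i • w j • (Y j.succ - Y i.succ) else 0 := by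
      rw [← Finset.sum_neg_distrib]
      refine Finset.sum_congr rfl fun j _ => ?_
      rw [← Finset.sum_neg_distrib]
      refine Finset.sum_congr rfl fun i _ => ?_
      by_cases h : x j = x i
      · rw [if_pos h, if_pos h.symm, smul_comm, ← smul_neg, ← smul_neg, neg_sub]
      · rw [if_neg h, if_neg (Ne.symm h), neg_zero]
    rw [h1]
    have h4 := h2.trans h3
    rwa [eq_neg_iff_add_eq_zero, ← two_smul ℝ, smul_eq_zero_iff_right two_ne_zero] at h4
  simp only [hd.succ_eq, smul_add, Finset.sum_add_distrib, Finset.smul_sum, h0, zero_add]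
  refine Finset.sum_congr rfl fun i _ => ?_
  rw [mul_smul, smul_comm]

end IsDrift

namespace IsScenario

variable (hs : IsScenario w x B L η δ)
include hs

/-- In the region, original agents are within `2η < 1` or more than `√2` apart, so only coefficients
with the zero agent can be ambiguous. -/
theorem exists_drift {Y v : Fin (n + 1) → Opinion d} (hY : InRegion x B L η Y)
    (hv : v ∈ filippovMap (field (Fin.cons δ w : Fin (n + 1) → ℝ)) Y) :
    ∃ θ, IsDrift w x δ Y v θ := by
  obtain ⟨Θ, hΘ, hv⟩ := exists_compatible_of_mem_filippovMap hv
  refine ⟨fun i => Θ 0 i.succ, fun i => hΘ.nonneg _ _, fun i => hΘ.le_one _ _,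
    fun i h => hΘ.eq_one _ _ (by rwa [norm_sub_rev]),
    fun i h => hΘ.eq_zero _ _ (by rwa [norm_sub_rev]), ?_, fun i => ?_⟩
  · rw [hv, Fin.sum_univ_succ]
    simp
  · rw [hv, Fin.sum_univ_succ, add_comm, Finset.sum_filter]
    congr 1
    · refine Finset.sum_congr rfl fun j _ => ?_
      split_ifs with h
      · rw [hΘ.eq_one, one_mul, Fin.cons_succ]
        have := hY.norm_sub_lt_of_eq h
        linarith [hs.tol_le]
      · rw [hΘ.eq_zero, zero_mul, zero_smul]
        have := hY.lt_norm_sub i j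
        have := hs.separated i j h
        have : (1 : ℝ) ≤ √2 := Real.one_le_sqrt.2 (by norm_num)
        linarith [hs.tol_pos]
    · rw [hΘ.symm, Fin.cons_zero, mul_comm]

theorem mem_cluster_iff {i j : Fin n} (h : x j = x i) : (j ∈ B ↔ i ∈ B) ∧ (j ∈ L ↔ i ∈ L) :=
  ⟨⟨fun hj => (hs.mem_captor j hj i).2 h.symm, fun hi => (hs.mem_captor i hi j).2 h⟩,
    ⟨fun hj => (hs.mem_loser j hj i).2 h.symm, fun hi => (hs.mem_loser i hi j).2 h⟩⟩

theorem le_clusterWeight (i : Fin n) : w i ≤ clusterWeight w x (x i) :=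
  Finset.single_le_sum (f := w) (fun j _ => (hs.weight_pos j).le) (by simp)

theorem clusterWeight_pos (i : Fin n) : 0 < clusterWeight w x (x i) :=
  (hs.weight_pos i).trans_le (hs.le_clusterWeight i)

end IsScenario

/-- A curve that moves with drift velocities and stays in the region up to time `τ`. -/
structure IsTrajectory (w : Fin n → ℝ) (x : Fin n → Opinion d) (B L : Finset (Fin n)) (η δ : ℝ)
    (X : ℝ → Fin (n + 1) → Opinion d) (τ : ℝ) : Prop where
  scenario : IsScenario w x B L η δ
  time_nonneg : 0 ≤ τ
  initial : ∀ i : Fin n, X 0 i.succ = x i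
  inside : ∀ i ∈ B, ‖X 0 0 - x i‖ < 1
  outside : ∀ i ∉ B, i ∉ L → 1 < ‖X 0 0 - x i‖
  absolutelyContinuous : ∀ s t, 0 ≤ s → s ≤ t → AbsolutelyContinuousOnInterval X s t
  drift : ∀ᵐ t : ℝ, t ∈ Set.Ioo 0 τ → ∃ v θ, HasDerivAt X v t ∧ InRegion x B L η (X t) ∧
    IsDrift w x δ (X t) v θ

/-! ### Cohesion of clusters and barriers along a trajectory -/

namespace IsTrajectory

variable {X : ℝ → Fin (n + 1) → Opinion d} {τ : ℝ}

theorem mono (ht : IsTrajectory w x B L η δ X τ) {σ : ℝ} (h0 : 0 ≤ σ) (h : σ ≤ τ) :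
    IsTrajectory w x B L η δ X σ :=
  { ht with
    time_nonneg := h0
    drift := by
      filter_upwards [ht.drift] with t h1 h2
      exact h1 ⟨h2.1, h2.2.trans_le h⟩ }

variable (ht : IsTrajectory w x B L η δ X τ)
include ht

theorem absolutelyContinuous_sub (i j : Fin (n + 1)) {s t : ℝ} (h0 : 0 ≤ s) (hst : s ≤ t) :
    AbsolutelyContinuousOnInterval (fun t => X t i - X t j) s t :=
  (absolutelyContinuousOnInterval_clm (ht.absolutelyContinuous s t h0 hst)
    (ContinuousLinearMap.proj (R := ℝ) (φ := fun _ => Opinion d) i)).sub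
  (absolutelyContinuousOnInterval_clm (ht.absolutelyContinuous s t h0 hst)
    (ContinuousLinearMap.proj (R := ℝ) (φ := fun _ => Opinion d) j))

omit ht in
theorem hasDerivAt_norm_sq {v : Fin (n + 1) → Opinion d} {t : ℝ} (h : HasDerivAt X v t)
    (i j : Fin (n + 1)) :
    HasDerivAt (fun t => ‖X t i - X t j‖ ^ 2) (2 * ⟪X t i - X t j, v i - v j⟫) t :=
  ((hasDerivAt_pi.1 h i).sub (hasDerivAt_pi.1 h j)).norm_sq

/-- The difference `D` of two agents of a cluster of weight `W` obeys `D' = -W D + δ e` with `|e| ≤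
c`, so `|D|` cannot exceed `δ c / W`. -/
theorem clusterWeight_mul_norm_sub_le {i j : Fin n} (hij : x j = x i) {c : ℝ} (hc : 0 ≤ c)
    (H : ∀ Y v θ, InRegion x B L η Y → IsDrift w x δ Y v θ →
      ‖θ i • (Y 0 - Y i.succ) - θ j • (Y 0 - Y j.succ)‖ ≤ c) :
    clusterWeight w x (x i) * ‖X τ i.succ - X τ j.succ‖ ≤ δ * c := by
  set W := clusterWeight w x (x i) with hW
  have hWpos : 0 < W := ht.scenario.clusterWeight_pos i
  have hδ := ht.scenario.zero_pos
  have key := le_of_ae_deriv_nonpos_above (K := (δ * c / W) ^ 2) ht.time_nonneg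
    (absolutelyContinuousOnInterval_norm_sq
      (ht.absolutelyContinuous_sub i.succ j.succ le_rfl ht.time_nonneg))
    (by rw [ht.initial, ht.initial, hij]; simp; positivity) (by
      filter_upwards [ht.drift] with t h1 h2 h3
      obtain ⟨v, θ, hX, hY, hd⟩ := h1 h2
      refine ⟨_, ?_, hasDerivAt_norm_sq hX _ _⟩
      set D := X t i.succ - X t j.succ with hD
      set e := θ i • (X t 0 - X t i.succ) - θ j • (X t 0 - X t j.succ) with he
      have hv : v i.succ - v j.succ = -(W • D) + δ • e := by
        rw [hd.succ_eq, hd.succ_eq, hij, hW, clusterWeight, Finset.sum_smul, he, hD, smul_sub δ,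
          mul_smul, mul_smul, ← Finset.sum_neg_distrib]
        rw [add_sub_add_comm, ← Finset.sum_sub_distrib]
        congr 1
        refine Finset.sum_congr rfl fun k _ => ?_
        rw [← smul_neg, ← smul_sub]
        congr 1
        abel
      have h4 : δ * c / W < ‖D‖ := lt_of_pow_lt_pow_left₀ 2 (norm_nonneg _) h3
      rw [div_lt_iff₀ hWpos] at h4
      have h5 : ⟪D, e⟫ ≤ ‖D‖ * c :=
        (real_inner_le_norm _ _).trans (mul_le_mul_of_nonneg_left (H _ _ _ hY hd) (norm_nonneg _))
      rw [hv, inner_add_right, inner_neg_right, inner_smul_right, inner_smul_right,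
        real_inner_self_eq_norm_sq]
      nlinarith [norm_nonneg D, mul_le_mul_of_nonneg_left h5 hδ.le,
        mul_le_mul_of_nonneg_left h4.le (norm_nonneg D)])
  have h6 := abs_le_of_sq_le_sq key (by positivity)
  have h7 := (le_div_iff₀ hWpos).1 ((le_abs_self _).trans h6)
  linarith

theorem clusterWeight_mul_norm_sub_le_two {i j : Fin n} (hij : x j = x i) :
    clusterWeight w x (x i) * ‖X τ i.succ - X τ j.succ‖ ≤ δ * 2 :=
  ht.clusterWeight_mul_norm_sub_le hij (by norm_num) fun Y v θ _ hd =>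
    (norm_sub_le _ _).trans (by linarith [hd.norm_smul_le i, hd.norm_smul_le j])

theorem eq_of_outside {i j : Fin n} (hij : x j = x i) (hB : i ∉ B) (hL : i ∉ L) :
    X τ i.succ = X τ j.succ := by
  have h := ht.clusterWeight_mul_norm_sub_le hij le_rfl fun Y v θ hY hd => by
    have hc := ht.scenario.mem_cluster_iff hij
    rw [hd.eq_zero i (hY.outside i hB hL), hd.eq_zero j (hY.outside j (mt hc.1.1 hB)
      (mt hc.2.1 hL))]
    simp
  rw [mul_zero] at h
  have h2 : ‖X τ i.succ - X τ j.succ‖ ≤ 0 :=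
    nonpos_of_mul_nonpos_right h (ht.scenario.clusterWeight_pos i)
  exact sub_eq_zero.1 (norm_le_zero_iff.1 h2)

/-- The original agents move with speed of the order of the weight of the zero agent. -/
theorem norm_drift_le {v : Fin (n + 1) → Opinion d} {θ : Fin n → ℝ}
    (hd : IsDrift w x δ (X τ) v θ) (i : Fin n) : ‖v i.succ‖ ≤ 3 * δ := by
  have hW := ht.scenario.clusterWeight_pos i
  have hδ := ht.scenario.zero_pos
  rw [hd.succ_eq]
  have h1 : ‖∑ j with x j = x i, w j • (X τ j.succ - X τ i.succ)‖ ≤ δ * 2 := by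
    calc _ ≤ ∑ j with x j = x i, w j * (δ * 2 / clusterWeight w x (x i)) := by
          refine (norm_sum_le _ _).trans (Finset.sum_le_sum fun j hj => ?_)
          rw [norm_smul, Real.norm_of_nonneg (ht.scenario.weight_pos j).le, norm_sub_rev]
          refine mul_le_mul_of_nonneg_left ?_ (ht.scenario.weight_pos j).le
          rw [le_div_iff₀ hW, mul_comm]
          exact ht.clusterWeight_mul_norm_sub_le_two (by simpa using hj)
      _ = clusterWeight w x (x i) * (δ * 2 / clusterWeight w x (x i)) := by
          rw [← Finset.sum_mul, clusterWeight]
      _ = δ * 2 := by field_simp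
  have h2 : ‖(δ * θ i) • (X τ 0 - X τ i.succ)‖ ≤ δ := by
    rw [mul_smul, norm_smul, Real.norm_of_nonneg hδ.le]
    exact mul_le_of_le_one_right hδ.le (hd.norm_smul_le i)
  exact (norm_add_le _ _).trans (by linarith)

theorem drift_eq_zero {v : Fin (n + 1) → Opinion d} {θ : Fin n → ℝ}
    (hY : InRegion x B L η (X τ)) (hd : IsDrift w x δ (X τ) v θ) {i : Fin n}
    (hB : i ∉ B) (hL : i ∉ L) : v i.succ = 0 := by
  rw [hd.succ_eq, hd.eq_zero i (hY.outside i hB hL), mul_zero, zero_smul, add_zero]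
  refine Finset.sum_eq_zero fun j hj => ?_
  rw [ht.eq_of_outside (by simpa using hj) hB hL, sub_self, smul_zero]

theorem norm_sq_le_of_drift {i j : Fin (n + 1)} {s K : ℝ} (hs0 : 0 ≤ s) (hsτ : s ≤ τ)
    (h0 : ‖X s i - X s j‖ ^ 2 ≤ K)
    (H : ∀ t v θ, 0 < t → t < τ → IsTrajectory w x B L η δ X t → InRegion x B L η (X t) →
      IsDrift w x δ (X t) v θ → K < ‖X t i - X t j‖ ^ 2 → ⟪X t i - X t j, v i - v j⟫ ≤ 0) :
    ‖X τ i - X τ j‖ ^ 2 ≤ K := by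
  refine le_of_ae_deriv_nonpos_above (g := fun t => ‖X t i - X t j‖ ^ 2) hsτ
    (absolutelyContinuousOnInterval_norm_sq (ht.absolutelyContinuous_sub i j hs0 hsτ)) h0 ?_
  filter_upwards [ht.drift] with t h1 h2 h3
  have h2' : t ∈ Set.Ioo 0 τ := ⟨hs0.trans_lt h2.1, h2.2⟩
  obtain ⟨v, θ, hX, hY, hd⟩ := h1 h2'
  refine ⟨_, ?_, hasDerivAt_norm_sq hX _ _⟩
  linarith [H t v θ h2'.1 h2'.2 (ht.mono h2'.1.le h2'.2.le) hY hd h3]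

theorem le_norm_sq_of_drift {i j : Fin (n + 1)} {s K : ℝ} (hs0 : 0 ≤ s) (hsτ : s ≤ τ)
    (h0 : K ≤ ‖X s i - X s j‖ ^ 2)
    (H : ∀ t v θ, 0 < t → t < τ → IsTrajectory w x B L η δ X t → InRegion x B L η (X t) →
      IsDrift w x δ (X t) v θ → ‖X t i - X t j‖ ^ 2 < K → 0 ≤ ⟪X t i - X t j, v i - v j⟫) :
    K ≤ ‖X τ i - X τ j‖ ^ 2 := by
  have := le_of_ae_deriv_nonpos_above (g := fun t => -‖X t i - X t j‖ ^ 2) (K := -K) hsτ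
    (absolutelyContinuousOnInterval_norm_sq (ht.absolutelyContinuous_sub i j hs0 hsτ)).neg
    (neg_le_neg h0) (by
      filter_upwards [ht.drift] with t h1 h2 h3
      have h2' : t ∈ Set.Ioo 0 τ := ⟨hs0.trans_lt h2.1, h2.2⟩
      obtain ⟨v, θ, hX, hY, hd⟩ := h1 h2'
      refine ⟨_, ?_, (hasDerivAt_norm_sq hX i j).neg⟩
      linarith [H t v θ h2'.1 h2'.2 (ht.mono h2'.1.le h2'.2.le) hY hd (neg_lt_neg_iff.1 h3)])
  exact neg_le_neg_iff.1 this

end IsTrajectory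

end OpinionDynamics

/-! ### Motion of the zero agent relative to the clusters -/

namespace OpinionDynamics

open scoped Classical RealInnerProductSpace

variable {n d : ℕ} {w : Fin n → ℝ} {x : Fin n → Opinion d} {B L : Finset (Fin n)} {η δ : ℝ}

theorem inner_sub_sub_eq {E : Type*} [NormedAddCommGroup E] [InnerProductSpace ℝ E] (z a b : E) :
    ⟪z - a, b - z⟫ = (‖b - a‖ ^ 2 - ‖z - a‖ ^ 2 - ‖z - b‖ ^ 2) / 2 := by
  have h := norm_add_sq_real (z - a) (b - z)
  rw [show z - a + (b - z) = b - a by abel, norm_sub_rev b z] at h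
  linarith

namespace IsDrift

variable {Y v : Fin (n + 1) → Opinion d} {θ : Fin n → ℝ}

theorem inner_zero (hd : IsDrift w x δ Y v θ) (u : Opinion d) :
    ⟪u, v 0⟫ = ∑ j, w j * (θ j * ⟪u, Y j.succ - Y 0⟫) := by
  rw [hd.zero_eq, inner_sum]
  refine Finset.sum_congr rfl fun j _ => ?_
  rw [inner_smul_right]
  ring

theorem abs_mul_inner_le (hd : IsDrift w x δ Y v θ) (u : Opinion d) (j : Fin n) :
    |θ j * ⟪u, Y j.succ - Y 0⟫| ≤ ‖u‖ := by
  rw [← inner_smul_right]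
  refine (abs_real_inner_le_norm _ _).trans ?_
  rw [← neg_sub, smul_neg, norm_neg]
  exact mul_le_of_le_one_right (norm_nonneg _) (hd.norm_smul_le j)

end IsDrift

namespace IsTrajectory

variable {X : ℝ → Fin (n + 1) → Opinion d} {τ : ℝ}
variable (ht : IsTrajectory w x B L η δ X τ)
include ht

theorem abs_inner_drift_le {v : Fin (n + 1) → Opinion d} {θ : Fin n → ℝ}
    (hd : IsDrift w x δ (X τ) v θ) (u : Opinion d) (i : Fin n) :
    |⟪u, v i.succ⟫| ≤ ‖u‖ * (3 * δ) :=
  (abs_real_inner_le_norm _ _).trans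
    (mul_le_mul_of_nonneg_left (ht.norm_drift_le hd i) (norm_nonneg _))

theorem inner_nonpos_of_mem_captor {v : Fin (n + 1) → Opinion d} {θ : Fin n → ℝ}
    (hY : InRegion x B L η (X τ)) (hd : IsDrift w x δ (X τ) v θ) {i : Fin n} (hi : i ∈ B)
    (h : (1 - η) ^ 2 < ‖X τ 0 - X τ i.succ‖ ^ 2) :
    ⟪X τ 0 - X τ i.succ, v 0 - v i.succ⟫ ≤ 0 := by
  have hs := ht.scenario
  set R := X τ 0 - X τ i.succ with hR
  have hR1 : ‖R‖ < 1 := hY.inside i hi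
  have h0 : ⟪R, v 0⟫ ≤ ∑ j, ((if j ∈ B then w j * (-(1 - η) ^ 2 + 2 * η) else 0) +
      if j ∈ L then w j else 0) := by
    rw [hd.inner_zero]
    refine Finset.sum_le_sum fun j _ => ?_
    have hw := hs.weight_pos j
    by_cases hB : j ∈ B
    · rw [if_pos hB, if_neg (Finset.disjoint_left.1 hs.disjoint hB), hd.eq_one j (hY.inside j hB),
        one_mul, add_zero]
      refine mul_le_mul_of_nonneg_left ?_ hw.le
      have h1 : X τ j.succ - X τ 0 = -R + (X τ j.succ - X τ i.succ) := by rw [hR]; abel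
      have h2 := hY.norm_sub_lt_of_eq ((hs.mem_captor i hi j).1 hB)
      have h3 : ⟪R, X τ j.succ - X τ i.succ⟫ ≤ 1 * (2 * η) :=
        (real_inner_le_norm _ _).trans (mul_le_mul hR1.le h2.le (norm_nonneg _) zero_le_one)
      rw [h1, inner_add_right, inner_neg_right, real_inner_self_eq_norm_sq]
      linarith
    · rw [if_neg hB, zero_add]
      by_cases hL : j ∈ L
      · rw [if_pos hL]
        exact mul_le_of_le_one_right hw.le
          ((le_abs_self _).trans ((hd.abs_mul_inner_le R j).trans hR1.le))
      · rw [if_neg hL, hd.eq_zero j (hY.outside j hB hL), zero_mul, mul_zero]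
  rw [Finset.sum_add_distrib, Finset.sum_ite_mem, Finset.sum_ite_mem, Finset.univ_inter,
    Finset.univ_inter, ← Finset.sum_mul] at h0
  have h1 := neg_le_of_abs_le (ht.abs_inner_drift_le hd R i)
  have h2 : w i ≤ ∑ j ∈ B, w j :=
    Finset.single_le_sum (f := w) (fun j _ => (hs.weight_pos j).le) hi
  have h3 : ‖R‖ * (3 * δ) ≤ 1 * (3 * δ) :=
    mul_le_mul_of_nonneg_right hR1.le (by linarith [hs.zero_pos])
  -- Budget in units of the captor's weight: its pull contributes `-4/5`, the loser at most `1/2`,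
  -- and the drift `3δ` of agent `i` at most `3/10`.
  have h4 : -(1 - η) ^ 2 + 2 * η ≤ -(4 / 5) := by nlinarith [hs.tol_le, hs.tol_pos]
  have h5 : (∑ j ∈ B, w j) * (-(1 - η) ^ 2 + 2 * η) ≤ (∑ j ∈ B, w j) * (-(4 / 5)) :=
    mul_le_mul_of_nonneg_left h4 (Finset.sum_nonneg fun j _ => (hs.weight_pos j).le)
  rw [inner_sub_right]
  linarith [hs.loser_light, hs.zero_le_weight i]

theorem norm_sub_lt_one {i : Fin n} (hi : i ∈ B) : ‖X τ 0 - X τ i.succ‖ < 1 := by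
  have hs := ht.scenario
  -- The zero agent may start closer than `η` to the sphere; the barrier is then its initial
  -- distance.
  have hlt : max (‖X 0 0 - X 0 i.succ‖ ^ 2) ((1 - η) ^ 2) < 1 := by
    refine max_lt ?_ ?_
    · rw [ht.initial]
      exact pow_lt_one₀ (norm_nonneg _) (ht.inside i hi) two_ne_zero
    · exact pow_lt_one₀ (by linarith [hs.tol_le]) (by linarith [hs.tol_pos]) two_ne_zero
  have h := ht.norm_sq_le_of_drift le_rfl ht.time_nonneg (le_max_left _ ((1 - η) ^ 2))
    fun t v θ _ _ ht' hY hd hK =>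
      ht'.inner_nonpos_of_mem_captor hY hd hi ((le_max_right _ _).trans_lt hK)
  exact (pow_lt_one_iff_of_nonneg (norm_nonneg _) two_ne_zero).1 (h.trans_lt hlt)

theorem inner_nonneg_of_outside {v : Fin (n + 1) → Opinion d} {θ : Fin n → ℝ}
    (hY : InRegion x B L η (X τ)) (hd : IsDrift w x δ (X τ) v θ) {i : Fin n} (hB : i ∉ B)
    (hL : i ∉ L) (h : ‖X τ 0 - X τ i.succ‖ ^ 2 < (1 + η) ^ 2) :
    0 ≤ ⟪X τ 0 - X τ i.succ, v 0 - v i.succ⟫ := by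
  have hs := ht.scenario
  have hη := hs.tol_pos
  rw [ht.drift_eq_zero hY hd hB hL, sub_zero, hd.inner_zero]
  refine Finset.sum_nonneg fun j _ => mul_nonneg (hs.weight_pos j).le ?_
  rcases lt_or_ge 1 ‖X τ 0 - X τ j.succ‖ with h1 | h1
  · rw [hd.eq_zero j h1, zero_mul]
  · refine mul_nonneg (hd.nonneg j) ?_
    -- An agent within reach cannot belong to the cluster of `i`, all of which is out of reach.
    have hne : x j ≠ x i := fun hij => by
      have hc := hs.mem_cluster_iff hij
      exact absurd (hY.outside j (mt hc.1.1 hB) (mt hc.2.1 hL)) (not_lt.2 h1)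
    have h2 := hY.lt_norm_sub i j
    have h3 := hs.separated i j hne
    have h4 : √2 + 2 * η ≤ ‖X τ j.succ - X τ i.succ‖ := by linarith
    have h5 : (√2 + 2 * η) ^ 2 ≤ ‖X τ j.succ - X τ i.succ‖ ^ 2 :=
      pow_le_pow_left₀ (by positivity) h4 2
    have h6 : √2 ^ 2 = 2 := Real.sq_sqrt (by norm_num)
    have h7 : (1 : ℝ) ≤ √2 := Real.one_le_sqrt.2 (by norm_num)
    have h8 : ‖X τ 0 - X τ j.succ‖ ^ 2 ≤ 1 := pow_le_one₀ (norm_nonneg _) h1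
    rw [inner_sub_sub_eq]
    -- Twice the inner product is at least `(4√2 - 2)η + 3η² > 0`.
    nlinarith

theorem one_lt_norm_sub {i : Fin n} (hB : i ∉ B) (hL : i ∉ L) : 1 < ‖X τ 0 - X τ i.succ‖ := by
  have hs := ht.scenario
  have hlt : 1 < min (‖X 0 0 - X 0 i.succ‖ ^ 2) ((1 + η) ^ 2) := by
    refine lt_min ?_ ?_
    · rw [ht.initial]
      exact one_lt_pow₀ (ht.outside i hB hL) two_ne_zero
    · exact one_lt_pow₀ (by linarith [hs.tol_pos]) two_ne_zero
  have h := ht.le_norm_sq_of_drift le_rfl ht.time_nonneg (min_le_left _ ((1 + η) ^ 2))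
    fun t v θ _ _ ht' hY hd hK =>
      ht'.inner_nonneg_of_outside hY hd hB hL (hK.trans_le (min_le_right _ _))
  exact (one_lt_pow_iff_of_nonneg (norm_nonneg _) two_ne_zero).1 (hlt.trans_le h)

theorem le_inner_of_mem_loser {v : Fin (n + 1) → Opinion d} {θ : Fin n → ℝ}
    (hY : InRegion x B L η (X τ)) (hd : IsDrift w x δ (X τ) v θ) {i : Fin n} (hi : i ∈ L)
    (h : ‖X τ 0 - X τ i.succ‖ ^ 2 ≤ (1 + η) ^ 2) :
    η ≤ 2 * ⟪X τ 0 - X τ i.succ, v 0 - v i.succ⟫ := by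
  have hs := ht.scenario
  have hη := hs.tol_pos
  set R := X τ 0 - X τ i.succ with hR
  have hR1 : ‖R‖ ≤ 1 + η := (sq_le_sq₀ (norm_nonneg _) (by linarith)).1 h
  have h0 : ∑ j, ((if j ∈ B then w j * (((‖x j - x i‖ - 2 * η) ^ 2 - (1 + η) ^ 2 - 1) / 2) else 0) +
      if j ∈ L then w j * (-(1 + η)) else 0) ≤ ⟪R, v 0⟫ := by
    rw [hd.inner_zero]
    refine Finset.sum_le_sum fun j _ => ?_
    have hw := hs.weight_pos j
    by_cases hB : j ∈ B
    · have hjL := Finset.disjoint_left.1 hs.disjoint hB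
      rw [if_pos hB, if_neg hjL, hd.eq_one j (hY.inside j hB), one_mul, add_zero]
      refine mul_le_mul_of_nonneg_left ?_ hw.le
      have h2 := hY.lt_norm_sub i j
      have h3 := hs.separated i j fun hij => hjL ((hs.mem_loser i hi j).2 hij)
      have h5 : (‖x j - x i‖ - 2 * η) ^ 2 ≤ ‖X τ j.succ - X τ i.succ‖ ^ 2 :=
        pow_le_pow_left₀ (by linarith [Real.sqrt_nonneg 2]) h2.le 2
      have h8 : ‖X τ 0 - X τ j.succ‖ ^ 2 ≤ 1 := pow_le_one₀ (norm_nonneg _) (hY.inside j hB).le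
      rw [hR, inner_sub_sub_eq]
      linarith
    · rw [if_neg hB, zero_add]
      by_cases hL : j ∈ L
      · rw [if_pos hL]
        refine mul_le_mul_of_nonneg_left ?_ hw.le
        exact (neg_le_neg hR1).trans (neg_le_of_abs_le (hd.abs_mul_inner_le R j))
      · rw [if_neg hL, hd.eq_zero j (hY.outside j hB hL), zero_mul, mul_zero]
  rw [Finset.sum_add_distrib, Finset.sum_ite_mem, Finset.sum_ite_mem, Finset.univ_inter,
    Finset.univ_inter, ← Finset.sum_mul] at h0
  have h1 := le_of_abs_le (ht.abs_inner_drift_le hd R i)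
  have h3 : ‖R‖ * (3 * δ) ≤ (1 + η) * (3 * δ) :=
    mul_le_mul_of_nonneg_right hR1 (by linarith [hs.zero_pos])
  have h4 : (1 + η) * (3 * δ) ≤ 2 * (3 * δ) :=
    mul_le_mul_of_nonneg_right (by linarith [hs.tol_le]) (by linarith [hs.zero_pos])
  have h5 : (1 + η) * (3 * δ) ≤ η / 2 := by nlinarith [hs.zero_le_tol, hs.tol_le, hs.zero_pos]
  rw [inner_sub_right]
  linarith [hs.loser_push i hi]

/-- The zero agent leaves the confidence ball of a loser in bounded time. -/
theorem one_lt_norm_sub_of_mem_loser {i : Fin n} (hi : i ∈ L) (hτ : 1 / η < τ) :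
    1 < ‖X τ 0 - X τ i.succ‖ := by
  have hs := ht.scenario
  have hη := hs.tol_pos
  by_contra! hle
  have hle2 : ‖X τ 0 - X τ i.succ‖ ^ 2 ≤ 1 := pow_le_one₀ (norm_nonneg _) hle
  -- Leaving the ball is irreversible, so being inside at `τ` means being inside all along. The
  -- squared distance would then have grown at rate `η` throughout, by more than one.
  have hbefore : ∀ s, 0 ≤ s → s ≤ τ → ‖X s 0 - X s i.succ‖ ^ 2 ≤ 1 := by
    intro s hs0 hsτ
    by_contra! hgt
    have hlt : 1 < min (‖X s 0 - X s i.succ‖ ^ 2) ((1 + η) ^ 2) :=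
      lt_min hgt (one_lt_pow₀ (by linarith) two_ne_zero)
    have h := ht.le_norm_sq_of_drift hs0 hsτ (min_le_left _ ((1 + η) ^ 2))
      fun t v θ _ _ ht' hY hd hK => by
        linarith [ht'.le_inner_of_mem_loser hY hd hi (hK.le.trans (min_le_right _ _))]
    linarith
  have h := sub_le_of_ae_deriv_le (g := fun t => -‖X t 0 - X t i.succ‖ ^ 2) (c := -η)
    ht.time_nonneg (absolutelyContinuousOnInterval_norm_sq
      (ht.absolutelyContinuous_sub 0 i.succ le_rfl ht.time_nonneg)).neg (by
      filter_upwards [ht.drift] with t h1 h2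
      obtain ⟨v, θ, hX, hY, hd⟩ := h1 h2
      refine ⟨_, ?_, (hasDerivAt_norm_sq hX 0 i.succ).neg⟩
      refine neg_le_neg ((ht.mono h2.1.le h2.2.le).le_inner_of_mem_loser hY hd hi ?_)
      exact (hbefore t h2.1.le h2.2.le).trans (one_le_pow₀ (by linarith)))
  rw [div_lt_iff₀ hη] at hτ
  have h3 : (0 : ℝ) ≤ ‖X 0 0 - X 0 i.succ‖ ^ 2 := sq_nonneg _
  simp only [sub_zero] at h
  linarith

theorem norm_momentum_sub_le {s t c : ℝ} (hs0 : 0 ≤ s) (hst : s ≤ t) (htτ : t ≤ τ) (hc : 0 ≤ c)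
    (a : Fin (n + 1) → ℝ)
    (H : ∀ r v θ, s < r → r < t → IsTrajectory w x B L η δ X r → InRegion x B L η (X r) →
      IsDrift w x δ (X r) v θ → ‖∑ k, a k • v k‖ ≤ c) :
    ‖∑ k, a k • X t k - ∑ k, a k • X s k‖ ≤ c * (t - s) := by
  set φ : (Fin (n + 1) → Opinion d) →L[ℝ] Opinion d :=
    ∑ k, a k • ContinuousLinearMap.proj (R := ℝ) (φ := fun _ => Opinion d) k with hφ
  have happ : ∀ Y, φ Y = ∑ k, a k • Y k := fun Y => by simp [hφ]
  rw [← happ, ← happ]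
  refine norm_sub_le_of_ae_deriv_norm_le (F := fun t => φ (X t)) hc hst
    (absolutelyContinuousOnInterval_clm (ht.absolutelyContinuous s t hs0 hst) φ) ?_
  filter_upwards [ht.drift] with r h1 h2
  have h2' : r ∈ Set.Ioo 0 τ := ⟨hs0.trans_lt h2.1, h2.2.trans_le htτ⟩
  obtain ⟨v, θ, hX, hY, hd⟩ := h1 h2'
  refine ⟨φ v, ?_, φ.hasFDerivAt.comp_hasDerivAt r hX⟩
  rw [happ]
  exact H r v θ h2.1 h2.2 (ht.mono h2'.1.le h2'.2.le) hY hd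

end IsTrajectory

end OpinionDynamics

/-! ### Momentum balance and displacement of the original agents -/

namespace OpinionDynamics

open scoped Classical RealInnerProductSpace

variable {n d : ℕ} {w : Fin n → ℝ} {x : Fin n → Opinion d} {B L : Finset (Fin n)} {η δ : ℝ}

/-- The coefficients of the total momentum of a set of agents, where the zero agent is given the
weight `c`. -/
noncomputable def momentumCoeff (w : Fin n → ℝ) (c : ℝ) (S : Finset (Fin n)) : Fin (n + 1) → ℝ :=
  Fin.cons c fun i => if i ∈ S then w i else 0

theorem sum_momentumCoeff_smul (w : Fin n → ℝ) (c : ℝ) (S : Finset (Fin n))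
    (Y : Fin (n + 1) → Opinion d) :
    ∑ k, momentumCoeff w c S k • Y k = c • Y 0 + ∑ i ∈ S, w i • Y i.succ := by
  simp [momentumCoeff, Fin.sum_univ_succ, ite_smul, Finset.sum_ite_mem]

theorem IsDrift.norm_sum_smul_le {Y v : Fin (n + 1) → Opinion d} {θ : Fin n → ℝ}
    (hd : IsDrift w x δ Y v θ) (hδ : 0 ≤ δ) (hw : ∀ i, 0 < w i) {S : Finset (Fin n)}
    (hS : ∀ i ∈ S, ∀ j, x j = x i → j ∈ S) :
    ‖∑ i ∈ S, w i • v i.succ‖ ≤ δ * ∑ i ∈ S, w i := by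
  rw [hd.sum_smul_drift hS, norm_smul, Real.norm_of_nonneg hδ]
  refine mul_le_mul_of_nonneg_left ((norm_sum_le _ _).trans (Finset.sum_le_sum fun i _ => ?_)) hδ
  rw [norm_smul, Real.norm_of_nonneg (hw i).le]
  exact mul_le_of_le_one_right (hw i).le (hd.norm_smul_le i)

namespace IsTrajectory

variable {X : ℝ → Fin (n + 1) → Opinion d} {τ : ℝ}
variable (ht : IsTrajectory w x B L η δ X τ)
include ht

/-- Up to time `1/η` the momentum changes at rate at most `δ` times the loser's weight; afterwards
the zero agent is out of reach and it is constant. -/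
theorem norm_loser_momentum_le :
    ‖∑ i ∈ L, w i • X τ i.succ - ∑ i ∈ L, w i • x i‖ ≤ δ * ((∑ i, w i) / η) := by
  have hs := ht.scenario
  have hη := hs.tol_pos
  have hδ := hs.zero_pos
  have hWn : 0 ≤ ∑ i ∈ L, w i := Finset.sum_nonneg fun i _ => (hs.weight_pos i).le
  have hWle : ∑ i ∈ L, w i ≤ ∑ i, w i :=
    Finset.sum_le_sum_of_subset_of_nonneg (Finset.subset_univ _)
      fun i _ _ => (hs.weight_pos i).le
  have hWn' := hWn.trans hWle
  have hsat : ∀ i ∈ L, ∀ j, x j = x i → j ∈ L := fun i hi j h => (hs.mem_loser i hi j).2 h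
  have hinit : ∑ i ∈ L, w i • x i = ∑ i ∈ L, w i • X 0 i.succ := by simp only [ht.initial]
  have hstart : ∀ t, 0 ≤ t → t ≤ τ → t ≤ 1 / η →
      ‖∑ i ∈ L, w i • X t i.succ - ∑ i ∈ L, w i • x i‖ ≤ δ * ((∑ i, w i) / η) := by
    intro t h0 htτ htη
    have h := ht.norm_momentum_sub_le (c := δ * ∑ i ∈ L, w i) le_rfl h0 htτ (by positivity)
      (momentumCoeff w 0 L) fun r v θ _ _ _ _ hd => by
        rw [sum_momentumCoeff_smul, zero_smul, zero_add]
        exact hd.norm_sum_smul_le hδ.le hs.weight_pos hsat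
    simp only [sum_momentumCoeff_smul, zero_smul, zero_add, sub_zero] at h
    rw [hinit]
    refine h.trans ?_
    calc δ * (∑ i ∈ L, w i) * t ≤ δ * (∑ i, w i) * (1 / η) := by gcongr
      _ = δ * ((∑ i, w i) / η) := by ring
  rcases le_or_gt τ (1 / η) with hle | hlt
  · exact hstart τ ht.time_nonneg le_rfl hle
  · have h0 : 0 ≤ 1 / η := by positivity
    have h := ht.norm_momentum_sub_le (c := 0) h0 hlt.le le_rfl le_rfl
      (momentumCoeff w 0 L) fun r v θ hr _ ht' _ hd => by
        rw [sum_momentumCoeff_smul, zero_smul, zero_add, hd.sum_smul_drift hsat,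
          Finset.sum_eq_zero, smul_zero, norm_zero]
        intro i hi
        rw [hd.eq_zero i (ht'.one_lt_norm_sub_of_mem_loser hi hr), zero_smul, smul_zero]
    simp only [sum_momentumCoeff_smul, zero_smul, zero_add, zero_mul] at h
    rw [sub_eq_zero.1 (norm_le_zero_iff.1 h)]
    exact hstart _ h0 hlt.le le_rfl

/-- The zero agent with weight `δ` together with `B ∪ L` conserves momentum, so the captor's change
balances those of the loser and the zero agent. No bound on the duration of the interaction is
needed. -/
theorem norm_captor_momentum_le :
    ‖∑ i ∈ B, w i • X τ i.succ - ∑ i ∈ B, w i • x i‖ ≤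
      δ * ((∑ i, w i) / η) + δ * ‖X τ 0 - X 0 0‖ := by
  have hs := ht.scenario
  have hδ := hs.zero_pos
  have hinit : ∀ S : Finset (Fin n), ∑ i ∈ S, w i • x i = ∑ i ∈ S, w i • X 0 i.succ := fun S => by
    simp only [ht.initial]
  have h := ht.norm_momentum_sub_le (c := 0) le_rfl ht.time_nonneg le_rfl le_rfl
    (momentumCoeff w δ (B ∪ L)) fun r v θ _ _ _ hY hd => by
      have hv0 : v 0 = -∑ i ∈ B ∪ L, w i • θ i • (X r 0 - X r i.succ) := by
        rw [hd.zero_eq, ← Finset.sum_neg_distrib]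
        refine (Finset.sum_subset_zero_on_sdiff (Finset.subset_univ _) (fun i hi => ?_)
          fun i _ => ?_).symm
        · simp only [Finset.mem_sdiff, Finset.mem_univ, true_and, Finset.mem_union, not_or] at hi
          rw [hd.eq_zero i (hY.outside i hi.1 hi.2), zero_mul, zero_smul]
        · rw [← neg_sub, smul_neg, smul_neg, neg_neg, smul_smul, mul_comm]
      rw [sum_momentumCoeff_smul, hd.sum_smul_drift, hv0, smul_neg, neg_add_cancel, norm_zero]
      intro i hi j hij
      have hc := hs.mem_cluster_iff hij
      rw [Finset.mem_union] at hi ⊢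
      exact hi.imp hc.1.2 hc.2.2
  simp only [sum_momentumCoeff_smul, zero_mul] at h
  rw [Finset.sum_union hs.disjoint, Finset.sum_union hs.disjoint] at h
  have h2 : ∑ i ∈ B, w i • X τ i.succ - ∑ i ∈ B, w i • x i =
      -(∑ i ∈ L, w i • X τ i.succ - ∑ i ∈ L, w i • x i) - δ • (X τ 0 - X 0 0) := by
    rw [hinit, hinit, ← sub_eq_zero, ← norm_le_zero_iff]
    refine le_of_eq_of_le ?_ h
    congr 1
    rw [smul_sub]
    abel
  rw [h2]
  refine (norm_sub_le _ _).trans (add_le_add ?_ ?_)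
  · rw [norm_neg]; exact ht.norm_loser_momentum_le
  · rw [norm_smul, Real.norm_of_nonneg hδ.le]

/-- The displacement of a member of a cluster is controlled by the momentum of the cluster. -/
theorem weight_mul_norm_sub_le_of_cluster {S : Finset (Fin n)} {i : Fin n}
    (hS : ∀ j, j ∈ S ↔ x j = x i) :
    w i * ‖X τ i.succ - x i‖ ≤
      ‖∑ j ∈ S, w j • X τ j.succ - ∑ j ∈ S, w j • x j‖ + δ * 2 := by
  have hs := ht.scenario
  have hW : clusterWeight w x (x i) = ∑ j ∈ S, w j := by
    rw [clusterWeight]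
    exact Finset.sum_congr (by ext j; simp [hS]) fun _ _ => rfl
  have hWpos := hs.clusterWeight_pos i
  have h1 : clusterWeight w x (x i) • (X τ i.succ - x i) =
      (∑ j ∈ S, w j • X τ j.succ - ∑ j ∈ S, w j • x j) +
        ∑ j ∈ S, w j • (X τ i.succ - X τ j.succ) := by
    rw [hW, Finset.sum_smul, ← Finset.sum_sub_distrib, ← Finset.sum_add_distrib]
    refine Finset.sum_congr rfl fun j hj => ?_
    rw [(hS j).1 hj, ← smul_sub, ← smul_add]
    congr 1
    abel
  have h2 : ‖∑ j ∈ S, w j • (X τ i.succ - X τ j.succ)‖ ≤ δ * 2 := by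
    calc _ ≤ ∑ j ∈ S, w j * (δ * 2 / clusterWeight w x (x i)) := by
          refine (norm_sum_le _ _).trans (Finset.sum_le_sum fun j hj => ?_)
          rw [norm_smul, Real.norm_of_nonneg (hs.weight_pos j).le]
          refine mul_le_mul_of_nonneg_left ?_ (hs.weight_pos j).le
          rw [le_div_iff₀ hWpos, mul_comm]
          exact ht.clusterWeight_mul_norm_sub_le_two ((hS j).1 hj)
      _ = δ * 2 := by rw [← Finset.sum_mul, ← hW]; field_simp
  calc w i * ‖X τ i.succ - x i‖ ≤ clusterWeight w x (x i) * ‖X τ i.succ - x i‖ :=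
        mul_le_mul_of_nonneg_right (hs.le_clusterWeight i) (norm_nonneg _)
    _ = ‖clusterWeight w x (x i) • (X τ i.succ - x i)‖ := by
        rw [norm_smul, Real.norm_of_nonneg hWpos.le]
    _ ≤ _ := by rw [h1]; exact (norm_add_le _ _).trans (by linarith)

theorem norm_sub_lt (i : Fin n) : ‖X τ i.succ - x i‖ < η := by
  have hs := ht.scenario
  have hη := hs.tol_pos
  have hδ := hs.zero_pos
  have hw := hs.weight_pos i
  have hsmall := hs.zero_small i
  have hA : 0 ≤ δ * ((∑ i, w i) / η) :=
    mul_nonneg hδ.le (div_nonneg (Finset.sum_nonneg fun i _ => (hs.weight_pos i).le) hη.le)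
  by_cases hB : i ∈ B
  · have h1 := ht.weight_mul_norm_sub_le_of_cluster (hs.mem_captor i hB)
    have h2 := ht.norm_captor_momentum_le
    have h3 : ‖X τ 0 - X 0 0‖ ≤ 2 + ‖X τ i.succ - x i‖ := by
      have h4 := (ht.norm_sub_lt_one hB).le
      have h5 := (ht.inside i hB).le
      calc ‖X τ 0 - X 0 0‖ = ‖(X τ 0 - X τ i.succ) + (X τ i.succ - x i) - (X 0 0 - x i)‖ := by
            congr 1; abel
        _ ≤ ‖X τ 0 - X τ i.succ‖ + ‖X τ i.succ - x i‖ + ‖X 0 0 - x i‖ :=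
            (norm_sub_le _ _).trans (by gcongr; exact norm_add_le _ _)
        _ ≤ _ := by linarith
    have h4 := mul_le_mul_of_nonneg_left h3 hδ.le
    have h5 : 10 * δ * ‖X τ i.succ - x i‖ ≤ w i * ‖X τ i.succ - x i‖ :=
      -- The captured zero agent moves along with agent `i`; this displacement enters with factor `δ
      -- ≤ w i / 10` and is absorbed on the left.
      mul_le_mul_of_nonneg_right (hs.zero_le_weight i) (norm_nonneg _)
    refine lt_of_mul_lt_mul_left ?_ hw.le
    linarith
  · by_cases hL : i ∈ L
    · have h1 := ht.weight_mul_norm_sub_le_of_cluster (hs.mem_loser i hL)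
      have h2 := ht.norm_loser_momentum_le
      refine lt_of_mul_lt_mul_left ?_ hw.le
      linarith
    · have h := ht.norm_momentum_sub_le (c := 0) le_rfl ht.time_nonneg le_rfl le_rfl
        (momentumCoeff w 0 {i}) fun r v θ _ _ ht' hY hd => by
          rw [sum_momentumCoeff_smul, zero_smul, zero_add, Finset.sum_singleton,
            ht'.drift_eq_zero hY hd hB hL, smul_zero, norm_zero]
      simp only [sum_momentumCoeff_smul, zero_smul, zero_add, zero_mul, Finset.sum_singleton,
        ← smul_sub, ht.initial, norm_smul, Real.norm_of_nonneg hw.le] at h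
      exact (nonpos_of_mul_nonpos_right h hw).trans_lt hη

theorem inRegion : InRegion x B L η (X τ) :=
  ⟨ht.norm_sub_lt, fun _ hi => ht.norm_sub_lt_one hi, fun _ hB hL => ht.one_lt_norm_sub hB hL⟩

end IsTrajectory

/-- Continuous induction: being in the open region before `τ` yields drift velocities there, and the
trajectory estimates then give membership at `τ` itself. -/
theorem IsScenario.inRegion_of_isSolution (hs : IsScenario w x B L η δ) {p : Opinion d}
    (hB : ∀ i ∈ B, ‖p - x i‖ < 1) (hout : ∀ i ∉ B, i ∉ L → 1 < ‖p - x i‖)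
    {X : ℝ → Fin (n + 1) → Opinion d}
    (hX : IsSolution (Fin.cons δ w : Fin (n + 1) → ℝ) (Fin.cons p x : Fin (n + 1) → Opinion d) X)
    {t : ℝ} (ht : 0 ≤ t) : InRegion x B L η (X t) := by
  have hac : ∀ s t, 0 ≤ s → s ≤ t → AbsolutelyContinuousOnInterval X s t := fun s t h0 hst =>
    -- `t + 1` rather than `t`, since solutions provide absolute continuity only on intervals of
    -- positive length.
    (hX.absolutelyContinuous (t + 1) (by linarith)).mono (by
      rw [Set.uIcc_of_le hst, Set.uIcc_of_le (by linarith)]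
      exact Set.Icc_subset_Icc h0 (by linarith))
  have hcont : ContinuousOn X (Set.Ici 0) := by
    intro s hs0
    have h := (hac 0 (s + 1) le_rfl (by linarith [Set.mem_Ici.1 hs0])).continuousOn
    rw [Set.uIcc_of_le (by linarith [Set.mem_Ici.1 hs0])] at h
    refine (h s ⟨hs0, by linarith⟩).mono_of_mem_nhdsWithin ?_
    rw [← Set.Ici_inter_Iic]
    exact inter_mem_nhdsWithin _ (Iic_mem_nhds (by linarith))
  have hp : X 0 0 = p := by rw [hX.initial, Fin.cons_zero]
  refine forall_mem_of_continuousOn hcont (isOpen_inRegion x B L η) (fun τ hτ hbefore => ?_) t ht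
  refine IsTrajectory.inRegion (w := w) (δ := δ) (τ := τ) ⟨hs, hτ, fun i => ?_, ?_, ?_, hac, ?_⟩
  · rw [hX.initial, Fin.cons_succ]
  · rwa [hp]
  · rwa [hp]
  · filter_upwards [hX.inclusion] with r h1 h2
    obtain ⟨v, hv, hd⟩ := h1 h2.1
    have hr := hbefore r h2.1.le h2.2
    obtain ⟨θ, hθ⟩ := hs.exists_drift hr hv
    exact ⟨v, θ, hd, hr, hθ⟩

/-! ### Choice of captor and loser -/

/-- A pair of clusters (or empty sets) for which a zero agent that interacts at most with these two
is expelled by `L` and captured by `B`. -/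
structure IsSplit (w : Fin n → ℝ) (x : Fin n → Opinion d) (B L : Finset (Fin n)) : Prop where
  disjoint : Disjoint B L
  mem_captor : ∀ i ∈ B, ∀ j, j ∈ B ↔ x j = x i
  mem_loser : ∀ i ∈ L, ∀ j, j ∈ L ↔ x j = x i
  loser_light : 2 * ∑ i ∈ L, w i ≤ ∑ i ∈ B, w i
  loser_push : ∀ i ∈ L, ∑ j ∈ L, w j < ∑ j ∈ B, w j * ((‖x j - x i‖ ^ 2 - 2) / 2)

/-- The separation and the push are strict at `η = 0`, so they survive a small `η`; with `η` fixed,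
the remaining conditions hold for small `δ`. -/
theorem IsSplit.eventually_isScenario (h : IsSplit w x B L) (hw : ∀ i, 0 < w i)
    (hsep : ∀ i j, x j ≠ x i → √2 < ‖x j - x i‖) {ε : ℝ} (hε : 0 < ε) :
    ∀ᶠ δ in 𝓝[>] (0 : ℝ), ∃ η ≤ ε, IsScenario w x B L η δ := by
  have h0 : ∀ᶠ η in 𝓝[>] (0 : ℝ), 0 < η ∧ η ≤ ε ∧ η ≤ 1 / 20 := by
    filter_upwards [self_mem_nhdsWithin, nhdsWithin_le_nhds (Iic_mem_nhds hε),
      nhdsWithin_le_nhds (Iic_mem_nhds (show (0 : ℝ) < 1 / 20 by norm_num))] with η h1 h2 h3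
    exact ⟨h1, h2, h3⟩
  have h1 : ∀ᶠ η in 𝓝[>] (0 : ℝ), ∀ i j, x j ≠ x i → √2 + 4 * η ≤ ‖x j - x i‖ := by
    refine eventually_all.2 fun i => eventually_all.2 fun j => nhdsWithin_le_nhds ?_
    by_cases hij : x j = x i
    · exact Eventually.of_forall fun η hne => absurd hij hne
    · have hc : Continuous fun η : ℝ => √2 + 4 * η := by fun_prop
      filter_upwards [hc.continuousAt.eventually_lt_const
        (show √2 + 4 * 0 < ‖x j - x i‖ by simpa using hsep i j hij)] with η hη _ using hη.le
  have h2 : ∀ᶠ η in 𝓝[>] (0 : ℝ), ∀ i ∈ L, (1 + η) * ∑ j ∈ L, w j + η ≤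
      ∑ j ∈ B, w j * (((‖x j - x i‖ - 2 * η) ^ 2 - (1 + η) ^ 2 - 1) / 2) := by
    refine eventually_all.2 fun i => nhdsWithin_le_nhds ?_
    by_cases hi : i ∈ L
    · have hc1 : Continuous fun η : ℝ => (1 + η) * ∑ j ∈ L, w j + η := by fun_prop
      have hc2 : Continuous fun η : ℝ =>
          ∑ j ∈ B, w j * (((‖x j - x i‖ - 2 * η) ^ 2 - (1 + η) ^ 2 - 1) / 2) := by fun_prop
      have hlt := h.loser_push i hi
      have hev := hc1.continuousAt.eventually_lt (x₀ := (0 : ℝ)) hc2.continuousAt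
        (lt_of_eq_of_lt (by ring) (hlt.trans_eq (Finset.sum_congr rfl fun j _ => by ring)))
      filter_upwards [hev] with η hη _ using hη.le
    · exact Eventually.of_forall fun η hmem => absurd hmem hi
  obtain ⟨η, ⟨hη0, hηε, hη1⟩, hη2, hη3⟩ := (h0.and (h1.and h2)).exists
  have hlin : ∀ c a : ℝ, 0 < a → ∀ᶠ δ in 𝓝[>] (0 : ℝ), c * δ < a := fun c a ha => by
    have hc : Continuous fun δ : ℝ => c * δ := by fun_prop
    exact nhdsWithin_le_nhds (hc.continuousAt.eventually_lt_const (by simpa using ha))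
  filter_upwards [self_mem_nhdsWithin, hlin 10 η hη0, eventually_all.2 fun i => hlin 10 _ (hw i),
    eventually_all.2 fun i => hlin (2 * ((∑ j, w j) / η + 4)) (η * w i) (mul_pos hη0 (hw i))]
    with δ hδ0 hδ1 hδ2 hδ3
  exact ⟨η, hηε, hw, hη0, hη1, hη2, h.disjoint, h.mem_captor, h.mem_loser, h.loser_light, hη3,
    hδ0, hδ1.le, fun i => (hδ2 i).le, fun i => by linarith [hδ3 i]⟩

theorem pairCenter_comm (w : Fin n → ℝ) (x : Fin n → Opinion d) (y z : Opinion d) :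
    pairCenter w x y z = pairCenter w x z y := by
  rw [pairCenter, pairCenter, add_comm, add_comm (clusterWeight w x y • y)]

theorem clusterWeight_pos (hw : ∀ i, 0 < w i) (i : Fin n) : 0 < clusterWeight w x (x i) :=
  (hw i).trans_le (Finset.single_le_sum (f := w) (fun j _ => (hw j).le) (by simp))

theorem norm_pairCenter_sub (hw : ∀ i, 0 < w i) (a b : Fin n) :
    ‖pairCenter w x (x a) (x b) - x a‖ * (clusterWeight w x (x a) + clusterWeight w x (x b)) =
      clusterWeight w x (x b) * ‖x b - x a‖ := by
  have ha := clusterWeight_pos (x := x) hw a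
  have hb := clusterWeight_pos (x := x) hw b
  set u := clusterWeight w x (x a)
  set v := clusterWeight w x (x b)
  have h : (u + v) • (pairCenter w x (x a) (x b) - x a) = v • (x b - x a) := by
    rw [pairCenter, smul_sub, smul_inv_smul₀ (by positivity), add_smul, smul_sub]
    abel
  have h2 := congrArg norm h
  rw [norm_smul, norm_smul, Real.norm_of_nonneg (by positivity), Real.norm_of_nonneg hb.le] at h2
  linarith

theorem sqrt_two_lt_norm_sub (hw : ∀ i, 0 < w i) {a b : Fin n}
    (h : √2 < ‖pairCenter w x (x a) (x b) - x a‖) : √2 < ‖x b - x a‖ := by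
  have ha := clusterWeight_pos (x := x) hw a
  have hb := clusterWeight_pos (x := x) hw b
  have h1 := norm_pairCenter_sub (x := x) hw a b
  nlinarith [norm_nonneg (pairCenter w x (x a) (x b) - x a)]

theorem isSplit_empty_right (hw : ∀ i, 0 < w i) (hB : ∀ i ∈ B, ∀ j, j ∈ B ↔ x j = x i) :
    IsSplit w x B ∅ :=
  ⟨Finset.disjoint_empty_right _, hB, by simp,
    by simpa using Finset.sum_nonneg fun i _ => (hw i).le, by simp⟩

/-- With `D = |x b - x a|`, the hypothesis reads `√2 W_a < W_b (D - √2)`. Since `D < 2`, this gives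
`W_a < (√2 - 1) W_b < W_b / 2`. -/
theorem isSplit_of_pair (hw : ∀ i, 0 < w i) {a b : Fin n} (hab : ‖x b - x a‖ < 2)
    (h : √2 < ‖pairCenter w x (x a) (x b) - x a‖) :
    IsSplit w x {j | x j = x b} {j | x j = x a} := by
  have ha := clusterWeight_pos (x := x) hw a
  have hb := clusterWeight_pos (x := x) hw b
  have h1 := norm_pairCenter_sub (x := x) hw a b
  have hD := sqrt_two_lt_norm_sub hw h
  have hsq : √2 ^ 2 = 2 := Real.sq_sqrt (by norm_num)
  have hs0 : (1.4 : ℝ) < √2 := Real.lt_sqrt_of_sq_lt (by norm_num)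
  have hs1 : √2 < 1.42 := (Real.sqrt_lt' (by norm_num)).2 (by norm_num)
  have hne : x b ≠ x a := fun he => by
    rw [he, sub_self, norm_zero] at hD
    linarith
  have h2 : √2 * (clusterWeight w x (x a) + clusterWeight w x (x b)) <
      clusterWeight w x (x b) * ‖x b - x a‖ := by
    rw [← h1]
    exact mul_lt_mul_of_pos_right h (by positivity)
  refine ⟨?_, ?_, ?_, ?_, ?_⟩
  · rw [Finset.disjoint_left]
    intro j hj hj2
    simp only [Finset.mem_filter, Finset.mem_univ, true_and] at hj hj2
    exact hne (hj.symm.trans hj2)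
  · intro i hi j
    simp only [Finset.mem_filter, Finset.mem_univ, true_and] at hi ⊢
    rw [hi]
  · intro i hi j
    simp only [Finset.mem_filter, Finset.mem_univ, true_and] at hi ⊢
    rw [hi]
  · change 2 * clusterWeight w x (x a) ≤ clusterWeight w x (x b)
    nlinarith
  · intro i hi
    simp only [Finset.mem_filter, Finset.mem_univ, true_and] at hi
    have h3 : ∑ j with x j = x b, w j * ((‖x j - x i‖ ^ 2 - 2) / 2) =
        clusterWeight w x (x b) * ((‖x b - x a‖ ^ 2 - 2) / 2) := by
      rw [clusterWeight, Finset.sum_mul]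
      refine Finset.sum_congr rfl fun j hj => ?_
      rw [hi, (Finset.mem_filter.1 hj).2]
    rw [h3]
    change clusterWeight w x (x a) < _
    -- From `D² - 2 = (D - √2)(D + √2)` and `D > √2`; the push then even exceeds `2 W_a`.
    have h4 : √2 * (‖x b - x a‖ - √2) ≤ (‖x b - x a‖ ^ 2 - 2) / 2 := by nlinarith
    nlinarith [mul_le_mul_of_nonneg_left h4 hb.le]

theorem exists_isSplit (hw : ∀ i, 0 < w i)
    (hball : ∀ y ∈ clusters x, ∀ z ∈ clusters x, ∀ u ∈ clusters x, y ≠ z → y ≠ u → z ≠ u →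
      Metric.ball y 1 ∩ Metric.ball z 1 ∩ Metric.ball u 1 = ∅)
    (hpair : ∀ y ∈ clusters x, ∀ z ∈ clusters x, y ≠ z →
      √2 < ‖pairCenter w x y z - y‖ ∨ √2 < ‖pairCenter w x y z - z‖)
    {p : Opinion d} (hp : ∀ i, ‖p - x i‖ ≠ 1) :
    ∃ B L, IsSplit w x B L ∧ (∀ i ∈ B, ‖p - x i‖ < 1) ∧ ∀ i ∉ B, i ∉ L → 1 < ‖p - x i‖ := by
  have hmem : ∀ i, x i ∈ clusters x := fun i => ⟨i, rfl⟩
  have hout : ∀ i, ¬ ‖p - x i‖ < 1 → 1 < ‖p - x i‖ := fun i h =>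
    lt_of_le_of_ne (not_lt.1 h) (hp i).symm
  by_cases hb : ∃ b, ‖p - x b‖ < 1
  swap
  · exact ⟨∅, ∅, isSplit_empty_right hw (by simp), by simp, fun i _ _ => hout i fun h => hb ⟨i, h⟩⟩
  obtain ⟨b, hb⟩ := hb
  by_cases ha : ∃ a, ‖p - x a‖ < 1 ∧ x a ≠ x b
  swap
  · refine ⟨({j | x j = x b} : Finset (Fin n)), ∅, isSplit_empty_right hw fun i hi j => ?_,
      fun i hi => ?_, fun i hi _ => hout i fun h => ?_⟩
    · simp only [Finset.mem_filter, Finset.mem_univ, true_and] at hi ⊢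
      rw [hi]
    · rw [(Finset.mem_filter.1 hi).2]; exact hb
    · exact ha ⟨i, h, by simpa using hi⟩
  obtain ⟨a, ha, hab⟩ := ha
  have hthird : ∀ i, x i ≠ x a → x i ≠ x b → 1 < ‖p - x i‖ := fun i hia hib =>
    hout i fun h => by
      have hempty := hball _ (hmem i) _ (hmem a) _ (hmem b) hia hib hab
      have : p ∈ Metric.ball (x i) 1 ∩ Metric.ball (x a) 1 ∩ Metric.ball (x b) 1 := by
        simp only [Set.mem_inter_iff, mem_ball_iff_norm]
        exact ⟨⟨h, ha⟩, hb⟩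
      rw [hempty] at this
      exact this
  have key : ∀ a b, ‖p - x a‖ < 1 → ‖p - x b‖ < 1 →
      (∀ i, x i ≠ x a → x i ≠ x b → 1 < ‖p - x i‖) →
      √2 < ‖pairCenter w x (x a) (x b) - x a‖ →
      ∃ B L, IsSplit w x B L ∧ (∀ i ∈ B, ‖p - x i‖ < 1) ∧ ∀ i ∉ B, i ∉ L → 1 < ‖p - x i‖ := by
    intro a b ha hb hthird h
    refine ⟨_, _, isSplit_of_pair hw ?_ h, fun i hi => ?_, fun i hB hL => ?_⟩
    · calc ‖x b - x a‖ = ‖(p - x a) - (p - x b)‖ := by congr 1; abel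
        _ ≤ ‖p - x a‖ + ‖p - x b‖ := norm_sub_le _ _
        _ < 2 := by linarith
    · rw [(Finset.mem_filter.1 hi).2]; exact hb
    · exact hthird i (by simpa using hL) (by simpa using hB)
  rcases hpair _ (hmem a) _ (hmem b) hab with h | h
  · exact key a b ha hb hthird h
  · rw [pairCenter_comm] at h
    exact key b a hb ha (fun i h1 h2 => hthird i h2 h1) h

end OpinionDynamics

/-! ### The exceptional null set and uniformity -/

theorem theorem4p5 {n d : ℕ} (w : Fin n → ℝ) (hw : ∀ i, 0 < w i)
    (x : Fin n → OpinionDynamics.Opinion d)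
    (hx : OpinionDynamics.IsEquilibrium w x)
    (hgen : OpinionDynamics.IsGeneric w x)
    (hscmc : ¬ OpinionDynamics.SharedCenterOfMass w x)
    (hball : ∀ y ∈ OpinionDynamics.clusters x, ∀ z ∈ OpinionDynamics.clusters x,
      ∀ u ∈ OpinionDynamics.clusters x, y ≠ z → y ≠ u → z ≠ u →
        Metric.ball y 1 ∩ Metric.ball z 1 ∩ Metric.ball u 1 = ∅)
    (hpair : ∀ y ∈ OpinionDynamics.clusters x, ∀ z ∈ OpinionDynamics.clusters x, y ≠ z →
      Real.sqrt 2 < ‖OpinionDynamics.pairCenter w x y z - y‖ ∨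
        Real.sqrt 2 < ‖OpinionDynamics.pairCenter w x y z - z‖) :
    OpinionDynamics.IsRobustAlmostSurelyUniformly w x := by
  have hsep : ∀ i j, x j ≠ x i → √2 < ‖x j - x i‖ := by
    intro i j hij
    rcases hpair (x i) ⟨i, rfl⟩ (x j) ⟨j, rfl⟩ hij.symm with h | h
    · exact OpinionDynamics.sqrt_two_lt_norm_sub hw h
    · rw [OpinionDynamics.pairCenter_comm] at h
      rw [norm_sub_rev]
      exact OpinionDynamics.sqrt_two_lt_norm_sub hw h
  refine ⟨⋃ i, Metric.sphere (x i) 1, ?_, ?_⟩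
  · exact measure_iUnion_null fun i => Measure.addHaar_sphere_of_ne_zero _ _ one_ne_zero
  · rw [ENNReal.tendsto_nhds_zero]
    intro ε hε
    obtain ⟨e, he0, heε⟩ := ENNReal.lt_iff_exists_nnreal_btwn.1 hε
    have he : (0 : ℝ) < e := by exact_mod_cast he0
    -- There are finitely many pairs `(B, L)`, so one range of `δ` serves every initial opinion.
    have hev : ∀ᶠ δ in 𝓝[>] (0 : ℝ), ∀ B L, OpinionDynamics.IsSplit w x B L →
        ∃ η ≤ (e : ℝ), OpinionDynamics.IsScenario w x B L η δ := by
      refine eventually_all.2 fun B => eventually_all.2 fun L => ?_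
      by_cases h : OpinionDynamics.IsSplit w x B L
      · filter_upwards [h.eventually_isScenario hw hsep he] with δ hδ _ using hδ
      · exact Eventually.of_forall fun δ h2 => absurd h2 h
    filter_upwards [hev] with δ hδ
    refine iSup₂_le fun p hp => ?_
    have hp' : ∀ i, ‖p - x i‖ ≠ 1 := by
      simpa [mem_sphere_iff_norm] using hp
    obtain ⟨B, L, hsplit, hB, hout⟩ := OpinionDynamics.exists_isSplit hw hball hpair hp'
    obtain ⟨η, hηe, hs⟩ := hδ B L hsplit
    refine iSup₂_le fun X hX => iSup₂_le fun t ht => iSup_le fun i => ?_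
    refine le_trans ?_ heε.le
    rw [ENNReal.ofReal_le_iff_le_toReal ENNReal.coe_ne_top, ENNReal.coe_toReal]
    exact ((hs.inRegion_of_isSolution hB hout hX ht).near i).le.trans hηe
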